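/- Let $d\ge 0$ be an integer. There exist constants $C,v>0$, depending only on $d$, such that the following holds for every finite $\Lambda\subset\mathbb{Z}^d$ (with Euclidean distance $|\cdot|$), all $J,U,\mu\in\mathbb{R}$ and all $p\ge 1$. Let $\mathcal F$ be the bosonic Fock space over $\Lambda$, with creation and annihilation operators $b_x^\dagger,b_x$ and number operators $n_x=b_x^\dagger b_x$, $x\in\Lambda$. For $Z\subset\Lambda$ put $$H_Z=\sum_{\substack{x,y\in Z\\ |x-y|=1}} J\,b_x^\dagger b_y+\sum_{\substack{x,y\in Z\\ |x-y|=1}}\bigl(U\,n_x^{p/2}n_y^{p/2}-\mu(n_x+n_y)\bigr)$$ (sums over ordered pairs) and $H=H_\Lambda$. For $X\subset\Lambda$ and $r>0$ let $X[r]=\{x\in\Lambda:\ |x-y|\le r\text{ for some }y\in X\}$. For $\nu>0$ and $R>2$ let $\Pi=\prod_{x\in X[R+2]}\mathbb{1}_{n_x\le\nu}$ and, for an operator $K$ on $\mathcal F$, let $\bar K=\Pi K\Pi$. Let $$\bar\tau_t(K)=e^{it\bar H}Ke^{-it\bar H},\qquad \bar\tau^R_t(K)=e^{it\overline{H_{X[R]}}}\,K\,e^{-it\overline{H_{X[R]}}}.$$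 Then for every $X\subset\Lambda$, $\nu>0$, $R>2$ and every bounded operator $A$ on $\mathcal F$ that is supported on $X$ (i.e. $A=B\otimes 1$ with respect to $\mathcal F=\mathcal F_X\otimes\mathcal F_{\Lambda\setminus X}$) and commutes with the total number operator $\sum_{x\in\Lambda}n_x$, $$\bigl\|\bar\tau_t(\bar A)-\bar\tau_t^R(\bar A)\bigr\|\le C\,|X|\,\|A\|\,R^d\,e^{-R}\bigl(e^{|J|\nu v|t|}-1\bigr)$$ for every $t\in\mathbb{R}$ with $|J|\,\nu\,v\,|t|\le R-2$. -/

import Mathlib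

set_option linter.unusedSectionVars false

noncomputable section

namespace BoseHubbard

/-! ### Bosonic Fock space and its elementary operators -/

section Fock

/-- Bosonic Fock space over a set `S` of sites, in the occupation-number representation: the
Hilbert space of square-summable complex functions of the occupation numbers `n : S → ℕ`.
For finite `S`, the normalised symmetrisation of `(x₁, …, x_N)`, where site `x` occurs `n x` times,
is the basis vector `|n⟩` in the usual identification with `ℂ ⊕ ⨁_{N ≥ 1} ℓ²ₛ(S^N)`. -/
abbrev Fock (S : Type) : Type := lp (fun _ : S → ℕ => ℂ) 2

/-- Formal operators: linear maps on the space of all complex functions of the occupation numbers.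
Such an operator `K` acts in Fock space on its maximal domain `{ψ ∈ Fock S | K ψ ∈ Fock S}`. -/
abbrev FormalOp (S : Type) : Type := Module.End ℂ ((S → ℕ) → ℂ)

variable {S : Type}

/-- The occupation-number basis vector `|n⟩`. -/
def basisVec [DecidableEq S] [Fintype S] (n : S → ℕ) : Fock S := lp.single 2 n (1 : ℂ)

/-- Annihilation operator: `b_x |n⟩ = √(n x) |n - e_x⟩`, written on coefficients. -/
def annih [DecidableEq S] (x : S) : FormalOp S where
  toFun f := fun n => ((Real.sqrt ((n x : ℝ) + 1) : ℝ) : ℂ) * f (n + Pi.single x 1)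
  map_add' f g := by funext n; simp [mul_add]
  map_smul' c f := by funext n; simp [mul_left_comm]

/-- Creation operator: `b_x† |n⟩ = √(n x + 1) |n + e_x⟩`, written on coefficients
(the coefficient at `n` vanishes if `n x = 0`). -/
def creat [DecidableEq S] (x : S) : FormalOp S where
  toFun f := fun n => ((Real.sqrt (n x : ℝ) : ℝ) : ℂ) * f (n - Pi.single x 1)
  map_add' f g := by funext n; simp [mul_add]
  map_smul' c f := by funext n; simp [mul_left_comm]

/-- Local number operator `n_x = b_x† b_x`. -/
def number [DecidableEq S] (x : S) : FormalOp S := creat x * annih x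

/-- Multiplication by a real function of the occupation numbers. -/
def diag (g : (S → ℕ) → ℝ) : FormalOp S where
  toFun f := fun n => (g n : ℂ) * f n
  map_add' f g := by funext n; simp [mul_add]
  map_smul' c f := by funext n; simp [mul_left_comm]

theorem annih_apply [DecidableEq S] (x : S) (f : (S → ℕ) → ℂ) (n : S → ℕ) :
    annih x f n = ((Real.sqrt ((n x : ℝ) + 1) : ℝ) : ℂ) * f (n + Pi.single x 1) := rfl

theorem creat_apply [DecidableEq S] (x : S) (f : (S → ℕ) → ℂ) (n : S → ℕ) :
    creat x f n = ((Real.sqrt (n x : ℝ) : ℝ) : ℂ) * f (n - Pi.single x 1) := rfl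

theorem diag_apply (g : (S → ℕ) → ℝ) (f : (S → ℕ) → ℂ) (n : S → ℕ) :
    diag g f n = (g n : ℂ) * f n := rfl

/-- `n_x` is multiplication by the occupation number of `x`; so `diag (fun n => h (n x))` is the
function `h(n_x)` of it. -/
theorem number_eq_diag [DecidableEq S] (x : S) : number x = diag fun n => (n x : ℝ) := by
  ext f n
  simp only [number, Module.End.mul_apply, creat_apply, annih_apply, diag_apply]
  rcases Nat.eq_zero_or_pos (n x) with h | h
  · simp [h]
  · have h1 : n - Pi.single x 1 + Pi.single x 1 = n := by
      funext z
      by_cases hz : z = x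
      · subst hz; simp; omega
      · simp [hz]
    have h2 : (((n - Pi.single x 1 : S → ℕ) x : ℕ) : ℝ) + 1 = n x := by
      have : ((n - Pi.single x 1 : S → ℕ) x) + 1 = n x := by simp; omega
      exact_mod_cast this
    rw [h1, h2, ← mul_assoc, ← Complex.ofReal_mul, Real.mul_self_sqrt (by positivity)]

/-- Total number operator `N = ∑_x n_x`. -/
def totalNumber (S : Type) [DecidableEq S] [Fintype S] : FormalOp S := ∑ x, number x

/-- A bounded operator `A` commutes with the (unbounded) operator `K` on its maximal domain:
`A K ⊆ K A`. -/
def CommutesWith (A : Fock S →L[ℂ] Fock S) (K : FormalOp S) : Prop :=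
  ∀ ψ φ : Fock S, K ⇑ψ = ⇑φ → K ⇑(A ψ) = ⇑(A φ)

/-- `A` is supported on `X`: `A = B ⊗ 1` for a bounded operator `B` on the Fock space over `X`,
under `Fock S = Fock X ⊗ Fock Xᶜ`. -/
def SupportedOn [DecidableEq S] [Fintype S] (X : Finset S) (A : Fock S →L[ℂ] Fock S) : Prop :=
  ∃ B : Fock X →L[ℂ] Fock X, ∀ m n : S → ℕ, A (basisVec n) m =
    open scoped Classical in
    if ∀ x, x ∉ X → m x = n x then B (basisVec fun x : X => n x) (fun x : X => m x) else 0

/-- The algebra of bounded operators supported on `X` that commute with the total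
number operator. -/
def IsInvariantLocal [DecidableEq S] [Fintype S] (X : Finset S) (A : Fock S →L[ℂ] Fock S) : Prop :=
  SupportedOn X A ∧ CommutesWith A (totalNumber S)

/-- The bounded operator given by a formal operator that is an `ℓ²` contraction. -/
def contraction (F : FormalOp S)
    (h : ∀ (f : Fock S) (s : Finset (S → ℕ)), ∑ m ∈ s, ‖F ⇑f m‖ ^ 2 ≤ ‖f‖ ^ 2) :
    Fock S →L[ℂ] Fock S :=
  LinearMap.mkContinuous
    { toFun := fun f => ⟨F ⇑f, memℓp_gen' (C := ‖f‖ ^ 2) (fun s => by simpa using h f s)⟩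
      map_add' := fun f g => by
        ext m
        change F (⇑f + ⇑g) m = (F ⇑f + F ⇑g) m
        rw [map_add]
      map_smul' := fun c f => by
        ext m
        change F (c • ⇑f) m = (c • F ⇑f) m
        rw [map_smul] }
    1 (fun f => by
      rw [one_mul]
      refine lp.norm_le_of_forall_sum_le (by simp) (norm_nonneg _) (fun s => ?_)
      simpa using h f s)

theorem contraction_apply (F : FormalOp S)
    (h : ∀ (f : Fock S) (s : Finset (S → ℕ)), ∑ m ∈ s, ‖F ⇑f m‖ ^ 2 ≤ ‖f‖ ^ 2) (f : Fock S) :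
    ⇑(contraction F h f) = F ⇑f := rfl

theorem sum_sq_le (f : Fock S) (s : Finset (S → ℕ)) : ∑ m ∈ s, ‖f m‖ ^ 2 ≤ ‖f‖ ^ 2 := by
  have := lp.sum_rpow_le_norm_rpow (p := 2) (by simp) f s
  simpa using this

/-- The value at `n` of the truncation `∏_{x ∈ Y} 1_{n_x ≤ ν}`. -/
def cutoff (Y : Finset S) (ν : ℝ) (n : S → ℕ) : ℝ :=
  open scoped Classical in ∏ x ∈ Y, if (n x : ℝ) ≤ ν then 1 else 0

theorem cutoff_mem (Y : Finset S) (ν : ℝ) (n : S → ℕ) :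
    0 ≤ cutoff Y ν n ∧ cutoff Y ν n ≤ 1 := by
  classical
  refine ⟨Finset.prod_nonneg fun x _ => ?_, Finset.prod_le_one (fun x _ => ?_) fun x _ => ?_⟩ <;>
  split_ifs <;> norm_num

/-- The projector `Π_{Y,ν} = ∏_{x ∈ Y} 1_{n_x ≤ ν}` as a formal operator. -/
def truncFormal (Y : Finset S) (ν : ℝ) : FormalOp S := diag (cutoff Y ν)

/-- The projector `Π_{Y,ν}` as a bounded operator on Fock space. -/
def trunc (Y : Finset S) (ν : ℝ) : Fock S →L[ℂ] Fock S :=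
  contraction (truncFormal Y ν) (fun f s => by
    refine le_trans (Finset.sum_le_sum fun m _ => ?_) (sum_sq_le f s)
    obtain ⟨h0, h1⟩ := cutoff_mem Y ν m
    simp only [truncFormal, diag_apply, norm_mul, Complex.norm_real, Real.norm_eq_abs,
      abs_of_nonneg h0]
    have : cutoff Y ν m * ‖f m‖ ≤ ‖f m‖ := mul_le_of_le_one_left (norm_nonneg _) h1
    gcongr)

/-- The truncation `Ā = Π A Π` of a bounded operator. -/
def barOp (Y : Finset S) (ν : ℝ) (A : Fock S →L[ℂ] Fock S) : Fock S →L[ℂ] Fock S :=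
  trunc Y ν * A * trunc Y ν

/-- The truncation `K̄ = Π K Π` of a formal operator. -/
def barFormal (Y : Finset S) (ν : ℝ) (K : FormalOp S) : FormalOp S :=
  truncFormal Y ν * K * truncFormal Y ν

end Fock

/-! ### The unitary group of a symmetric, particle-number preserving operator -/

section Evolution

variable {S : Type} [DecidableEq S] [Fintype S]

/-- The finite set of occupation numbers with `N` particles. -/
def sector (S : Type) [DecidableEq S] [Fintype S] (N : ℕ) : Finset (S → ℕ) :=
  Finset.piAntidiag Finset.univ N

theorem mem_sector {N : ℕ} {m : S → ℕ} : m ∈ sector S N ↔ ∑ x, m x = N := by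
  simp [sector]

/-- Matrix element `⟨m, K n⟩`. -/
def elt (K : FormalOp S) (m n : S → ℕ) : ℂ := K (Pi.single n 1) m

/-- `K` preserves the particle number and is given by a Hermitian matrix in each (finite
dimensional) sector of fixed particle number. Such an operator is self-adjoint on its maximal
domain, being the direct sum of its sectors. -/
structure IsSectorHermitian (K : FormalOp S) : Prop where
  apply_eq : ∀ f m, K f m = ∑ n ∈ sector S (∑ x, m x), elt K m n * f n
  herm : ∀ m n, elt K m n = star (elt K n m)

/-- The matrix of `K` in the `N`-particle sector. -/
def block (K : FormalOp S) (N : ℕ) : Matrix (sector S N) (sector S N) ℂ :=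
  fun m n => elt K m n

/-- `e^{itK}`, sector by sector, where it is the exponential of a matrix. -/
def evolFormal (K : FormalOp S) (t : ℝ) : FormalOp S where
  toFun f := fun m => ∑ n : sector S (∑ x, m x),
    NormedSpace.exp ((Complex.I * t) • block K (∑ x, m x)) ⟨m, mem_sector.2 rfl⟩ n * f n
  map_add' f g := by funext m; simp [mul_add, Finset.sum_add_distrib]
  map_smul' c f := by funext m; simp [mul_left_comm, Finset.mul_sum]

theorem evolFormal_apply (K : FormalOp S) (t : ℝ) (f : (S → ℕ) → ℂ) {N : ℕ} (m : sector S N) :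
    evolFormal K t f m =
      (NormedSpace.exp ((Complex.I * t) • block K N)).mulVec (fun n => f n) m := by
  obtain ⟨m, hm⟩ := m
  obtain rfl := mem_sector.1 hm
  rfl

theorem block_conjTranspose {K : FormalOp S} (hK : IsSectorHermitian K) (N : ℕ) :
    (block K N).conjTranspose = block K N := by
  ext m n
  exact (hK.herm m n).symm

theorem exp_block_unitary {K : FormalOp S} (hK : IsSectorHermitian K) (N : ℕ) (t : ℝ) :
    (NormedSpace.exp ((Complex.I * t) • block K N)).conjTranspose *
      NormedSpace.exp ((Complex.I * t) • block K N) = 1 := by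
  have h : ((Complex.I * t) • block K N).conjTranspose = -((Complex.I * t) • block K N) := by
    rw [Matrix.conjTranspose_smul, block_conjTranspose hK]
    simp
  rw [← Matrix.exp_conjTranspose, h,
    ← Matrix.exp_add_of_commute _ _ (Commute.refl ((Complex.I * t) • block K N)).neg_left]
  simp

theorem sum_norm_sq_mulVec {ι : Type} [Fintype ι] [DecidableEq ι] (U : Matrix ι ι ℂ)
    (hU : U.conjTranspose * U = 1) (v : ι → ℂ) :
    ∑ i, ‖U.mulVec v i‖ ^ 2 = ∑ i, ‖v i‖ ^ 2 := by
  have key : ∀ w : ι → ℂ, ((∑ i, ‖w i‖ ^ 2 : ℝ) : ℂ) = dotProduct (star w) w := by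
    intro w
    simp [dotProduct, Complex.conj_mul']
  have : dotProduct (star (U.mulVec v)) (U.mulVec v) = dotProduct (star v) v := by
    rw [Matrix.star_mulVec, ← Matrix.dotProduct_mulVec, Matrix.mulVec_mulVec, hU,
      Matrix.one_mulVec]
  rw [← key, ← key] at this
  exact_mod_cast this

theorem evolFormal_contraction {K : FormalOp S} (hK : IsSectorHermitian K) (t : ℝ)
    (f : Fock S) (s : Finset (S → ℕ)) : ∑ m ∈ s, ‖evolFormal K t ⇑f m‖ ^ 2 ≤ ‖f‖ ^ 2 := by
  set T : Finset ℕ := s.image fun m => ∑ x, m x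
  have hdis : (T : Set ℕ).PairwiseDisjoint (sector S) := by
    intro a _ b _ hab
    refine Finset.disjoint_left.2 fun m ha hb => hab ?_
    rw [← mem_sector.1 ha, ← mem_sector.1 hb]
  have hs : s ⊆ T.biUnion (sector S) := fun m hm =>
    Finset.mem_biUnion.2 ⟨_, Finset.mem_image_of_mem _ hm, mem_sector.2 rfl⟩
  calc ∑ m ∈ s, ‖evolFormal K t ⇑f m‖ ^ 2
      ≤ ∑ m ∈ T.biUnion (sector S), ‖evolFormal K t ⇑f m‖ ^ 2 :=
        Finset.sum_le_sum_of_subset_of_nonneg hs fun _ _ _ => by positivity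
    _ = ∑ N ∈ T, ∑ m ∈ sector S N, ‖evolFormal K t ⇑f m‖ ^ 2 := Finset.sum_biUnion hdis
    _ = ∑ N ∈ T, ∑ m ∈ sector S N, ‖f m‖ ^ 2 := by
        refine Finset.sum_congr rfl fun N _ => ?_
        rw [← Finset.sum_coe_sort (sector S N), ← Finset.sum_coe_sort (sector S N)]
        simp_rw [evolFormal_apply]
        exact sum_norm_sq_mulVec _ (exp_block_unitary hK N t) fun n => f n
    _ = ∑ m ∈ T.biUnion (sector S), ‖f m‖ ^ 2 := (Finset.sum_biUnion hdis).symm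
    _ ≤ ‖f‖ ^ 2 := sum_sq_le f _

/-- The unitary `e^{itK}` on Fock space. -/
def evolution (K : FormalOp S) (hK : IsSectorHermitian K) (t : ℝ) : Fock S →L[ℂ] Fock S :=
  contraction (evolFormal K t) (evolFormal_contraction hK t)

theorem evolution_zero (K : FormalOp S) (hK : IsSectorHermitian K) : evolution K hK 0 = 1 := by
  ext f m
  have h := evolFormal_apply K 0 ⇑f (⟨m, mem_sector.2 rfl⟩ : sector S (∑ x, m x))
  simp only [Complex.ofReal_zero, mul_zero, zero_smul, NormedSpace.exp_zero,
    Matrix.one_mulVec] at h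
  exact h

/-- `evolution K hK t` solves the Schrödinger equation generated by `iK`: the definition is the
usual `e^{itK}`. -/
theorem evolution_hasDerivAt (K : FormalOp S) (hK : IsSectorHermitian K) (t : ℝ) (f : Fock S)
    (m : S → ℕ) :
    HasDerivAt (fun t => evolution K hK t f m) (Complex.I * K ⇑(evolution K hK t f) m) t := by
  let _ := (Matrix.linftyOpNormedRing : NormedRing (Matrix (sector S (∑ x, m x)) _ ℂ))
  let _ : NormedAlgebra ℝ (Matrix (sector S (∑ x, m x)) (sector S (∑ x, m x)) ℂ) :=
    Matrix.linftyOpNormedAlgebra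
  let m' : sector S (∑ x, m x) := ⟨m, mem_sector.2 rfl⟩
  set B := block K (∑ x, m x) with hB
  have h1 : ∀ t : ℝ, (Complex.I * (t : ℂ)) • B = t • (Complex.I • B) := fun t => by
    rw [mul_comm, mul_smul]; rfl
  have h2 := hasDerivAt_exp_smul_const' (𝕂 := ℝ) (Complex.I • B) t
  have h3 : ∀ t : ℝ, evolution K hK t f m =
      ∑ n, NormedSpace.exp (t • (Complex.I • B)) m' n * f n := fun t => by
    rw [← h1]; rfl
  have h4 : HasDerivAt (fun t : ℝ => ∑ n, NormedSpace.exp (t • (Complex.I • B)) m' n * f n)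
      (∑ n, ((Complex.I • B) * NormedSpace.exp (t • (Complex.I • B))) m' n * f n) t := by
    refine HasDerivAt.fun_sum fun n _ => HasDerivAt.mul_const ?_ _
    exact hasDerivAt_pi.1 (hasDerivAt_pi.1 h2 m') n
  have h5 : Complex.I * K ⇑(evolution K hK t f) m =
      ∑ n, ((Complex.I • B) * NormedSpace.exp (t • (Complex.I • B))) m' n * f n := by
    rw [hK.apply_eq, ← Finset.sum_coe_sort]
    have h6 : ∀ n : sector S (∑ x, m x), evolution K hK t f n =
        (NormedSpace.exp (t • (Complex.I • B))).mulVec (fun n => f n) n := fun n => by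
      rw [← h1]; exact evolFormal_apply K t ⇑f n
    simp_rw [h6]
    change Complex.I * B.mulVec ((NormedSpace.exp (t • (Complex.I • B))).mulVec
      fun n => f n) m' = (((Complex.I • B) * NormedSpace.exp (t • (Complex.I • B))).mulVec
      fun n => f n) m'
    rw [← Matrix.mulVec_mulVec, Matrix.smul_mulVec]
    rfl
  rw [h5]
  simp_rw [h3]
  exact h4

/-- The Heisenberg dynamics `A ↦ e^{itK} A e^{-itK}`. -/
def heisenberg (K : FormalOp S) (hK : IsSectorHermitian K) (t : ℝ) (A : Fock S →L[ℂ] Fock S) :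
    Fock S →L[ℂ] Fock S :=
  evolution K hK t * A * evolution K hK (-t)

end Evolution

/-! ### The Bose–Hubbard Hamiltonian on a finite part of `ℤ^d` -/

section Hamiltonian

variable {d : ℕ}

/-- Euclidean distance on `ℤ^d`. -/
def latticeDist (x y : Fin d → ℤ) : ℝ := Real.sqrt (∑ i, ((x i : ℝ) - (y i : ℝ)) ^ 2)

/-- `T_{xy} = J b_x† b_y`. -/
def hop {S : Type} [DecidableEq S] (J : ℝ) (x y : S) : FormalOp S := (J : ℂ) • (creat x * annih y)

/-- `V_{xy} = U n_x^{p/2} n_y^{p/2} - μ (n_x + n_y)`. -/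
def pot {S : Type} [DecidableEq S] (U μ p : ℝ) (x y : S) : FormalOp S :=
  (U : ℂ) • (diag (fun n => (n x : ℝ) ^ (p / 2)) * diag (fun n => (n y : ℝ) ^ (p / 2)))
    - (μ : ℂ) • (number x + number y)

/-- `H_Z = T_Z + V_Z`, where `T_Z` and `V_Z` are the sums of `T_{xy}` and `V_{xy}` over the ordered
pairs `x, y ∈ Z` with `|x - y| = 1`. -/
def hamiltonian (Λ : Finset (Fin d → ℤ)) (J U μ p : ℝ) (Z : Finset Λ) : FormalOp Λ :=
  open scoped Classical in
  (∑ x ∈ Z, ∑ y ∈ Z, if latticeDist x.1 y.1 = 1 then hop J x y else 0)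
    + ∑ x ∈ Z, ∑ y ∈ Z, if latticeDist x.1 y.1 = 1 then pot U μ p x y else 0

/-- The enlargement `X[R] = {x ∈ Λ | d(x, X) ≤ R}`. -/
def enlarge {Λ : Finset (Fin d → ℤ)} (X : Finset Λ) (R : ℝ) : Finset Λ :=
  open scoped Classical in
  Finset.univ.filter fun x => ∃ y ∈ X, latticeDist x.1 y.1 ≤ R

end Hamiltonian

/-! ### The truncated Hamiltonian satisfies `IsSectorHermitian` -/

section Hermitian

variable {S : Type} [DecidableEq S] [Fintype S]

theorem creat_annih_apply_add (x y : S) (f : (S → ℕ) → ℂ) (k : S → ℕ) :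
    (creat x * annih y) f (k + Pi.single x 1) =
      ((Real.sqrt ((k x : ℝ) + 1) * Real.sqrt ((k y : ℝ) + 1) : ℝ) : ℂ) *
        f (k + Pi.single y 1) := by
  simp [creat_apply, annih_apply, mul_assoc]

theorem creat_annih_apply_zero (x y : S) (f : (S → ℕ) → ℂ) (m : S → ℕ) (h : m x = 0) :
    (creat x * annih y) f m = 0 := by
  simp [creat_apply, h]

theorem exists_eq_add_single (x : S) (m : S → ℕ) (h : m x ≠ 0) :
    ∃ k : S → ℕ, m = k + Pi.single x 1 := by
  refine ⟨m - Pi.single x 1, ?_⟩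
  funext z
  by_cases hz : z = x
  · subst hz; simp; omega
  · simp [hz]

theorem elt_creat_annih (x y : S) (k n : S → ℕ) :
    elt (creat x * annih y) (k + Pi.single x 1) n = if n = k + Pi.single y 1 then
      ((Real.sqrt ((k x : ℝ) + 1) * Real.sqrt ((k y : ℝ) + 1) : ℝ) : ℂ) else 0 := by
  rw [elt, creat_annih_apply_add, Pi.single_apply]
  simp [eq_comm]

theorem elt_creat_annih_symm (x y : S) (m n : S → ℕ) :
    elt (creat x * annih y) m n = star (elt (creat y * annih x) n m) := by
  have aux : ∀ (x y : S) (m n : S → ℕ),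
      (¬ ∃ k : S → ℕ, m = k + Pi.single x 1 ∧ n = k + Pi.single y 1) →
      elt (creat x * annih y) m n = 0 := by
    intro x y m n h
    by_cases hm : m x = 0
    · exact creat_annih_apply_zero x y _ m hm
    · obtain ⟨k, rfl⟩ := exists_eq_add_single x m hm
      rw [elt_creat_annih, if_neg fun hn => h ⟨k, rfl, hn⟩]
  by_cases h : ∃ k : S → ℕ, m = k + Pi.single x 1 ∧ n = k + Pi.single y 1
  · obtain ⟨k, rfl, rfl⟩ := h
    rw [elt_creat_annih, elt_creat_annih, if_pos rfl, if_pos rfl, mul_comm]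
    simp
  · rw [aux x y m n h, aux y x n m fun ⟨k, h1, h2⟩ => h ⟨k, h2, h1⟩, star_zero]

/-- The first half of `IsSectorHermitian`. -/
def PreservesSectors (K : FormalOp S) : Prop :=
  ∀ f m, K f m = ∑ n ∈ sector S (∑ x, m x), elt K m n * f n

theorem PreservesSectors.zero : PreservesSectors (0 : FormalOp S) := fun f m => by
  simp [elt]

theorem PreservesSectors.add {K L : FormalOp S} (hK : PreservesSectors K)
    (hL : PreservesSectors L) : PreservesSectors (K + L) := fun f m => by
  simp only [elt, LinearMap.add_apply, Pi.add_apply, add_mul, Finset.sum_add_distrib]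
  rw [hK f m, hL f m]
  rfl

theorem PreservesSectors.sum {ι : Type} (s : Finset ι) {K : ι → FormalOp S}
    (hK : ∀ i ∈ s, PreservesSectors (K i)) : PreservesSectors (∑ i ∈ s, K i) :=
  Finset.sum_induction K PreservesSectors (fun _ _ => PreservesSectors.add) PreservesSectors.zero hK

theorem PreservesSectors.smul {K : FormalOp S} (c : ℂ) (hK : PreservesSectors K) :
    PreservesSectors (c • K) := fun f m => by
  simp only [elt, LinearMap.smul_apply, Pi.smul_apply, smul_eq_mul, mul_assoc]
  rw [hK f m, Finset.mul_sum]
  rfl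

theorem PreservesSectors.diag (g : (S → ℕ) → ℝ) : PreservesSectors (diag g) := fun f m => by
  simp only [elt, diag_apply, Pi.single_apply]
  rw [Finset.sum_eq_single_of_mem m (mem_sector.2 rfl) fun n _ hn => by simp [Ne.symm hn]]
  simp

theorem PreservesSectors.creat_annih (x y : S) : PreservesSectors (creat x * annih y) := by
  intro f m
  by_cases hm : m x = 0
  · rw [creat_annih_apply_zero x y f m hm, Finset.sum_eq_zero]
    intro n _
    rw [elt, creat_annih_apply_zero x y _ m hm, zero_mul]
  · obtain ⟨k, rfl⟩ := exists_eq_add_single x m hm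
    rw [creat_annih_apply_add,
      Finset.sum_eq_single_of_mem (k + Pi.single y 1)
        (mem_sector.2 (by simp [Finset.sum_add_distrib]))
        fun n _ hn => by rw [elt_creat_annih, if_neg hn, zero_mul],
      elt_creat_annih, if_pos rfl]

theorem elt_add (K L : FormalOp S) (m n : S → ℕ) : elt (K + L) m n = elt K m n + elt L m n := rfl

theorem elt_sum {ι : Type} (s : Finset ι) (K : ι → FormalOp S) (m n : S → ℕ) :
    elt (∑ i ∈ s, K i) m n = ∑ i ∈ s, elt (K i) m n := by
  simp [elt, LinearMap.sum_apply, Finset.sum_apply]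

theorem elt_smul (c : ℂ) (K : FormalOp S) (m n : S → ℕ) : elt (c • K) m n = c * elt K m n := rfl

theorem elt_ite (q : Prop) [Decidable q] (K : FormalOp S) (m n : S → ℕ) :
    elt (if q then K else 0) m n = if q then elt K m n else 0 := by
  split_ifs <;> rfl

theorem elt_diag (g : (S → ℕ) → ℝ) (m n : S → ℕ) :
    elt (diag g) m n = if m = n then (g m : ℂ) else 0 := by
  simp [elt, diag_apply, Pi.single_apply]

theorem IsSectorHermitian.diag (g : (S → ℕ) → ℝ) : IsSectorHermitian (diag g) := by
  refine ⟨PreservesSectors.diag g, fun m n => ?_⟩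
  rw [elt_diag, elt_diag]
  by_cases h : m = n
  · subst h; simp
  · simp [h, Ne.symm h]

theorem IsSectorHermitian.add {K L : FormalOp S} (hK : IsSectorHermitian K)
    (hL : IsSectorHermitian L) : IsSectorHermitian (K + L) :=
  ⟨PreservesSectors.add hK.apply_eq hL.apply_eq, fun m n => by
    rw [elt_add, elt_add, star_add, ← hK.herm, ← hL.herm]⟩

theorem IsSectorHermitian.zero : IsSectorHermitian (0 : FormalOp S) :=
  ⟨PreservesSectors.zero, fun m n => by simp [elt]⟩

theorem IsSectorHermitian.sum {ι : Type} (s : Finset ι) {K : ι → FormalOp S}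
    (hK : ∀ i ∈ s, IsSectorHermitian (K i)) : IsSectorHermitian (∑ i ∈ s, K i) :=
  Finset.sum_induction K IsSectorHermitian (fun _ _ => IsSectorHermitian.add)
    IsSectorHermitian.zero hK

theorem pot_eq_diag (U μ p : ℝ) (x y : S) : pot U μ p x y = diag fun n : S → ℕ =>
    U * ((n x : ℝ) ^ (p / 2) * (n y : ℝ) ^ (p / 2)) - μ * (n x + n y) := by
  ext f n
  simp only [pot, number_eq_diag, LinearMap.sub_apply, LinearMap.smul_apply, Pi.sub_apply,
    Pi.smul_apply, Module.End.mul_apply, LinearMap.add_apply, Pi.add_apply, diag_apply, smul_eq_mul]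
  push_cast
  ring

theorem IsSectorHermitian.hamiltonian {d : ℕ} (Λ : Finset (Fin d → ℤ)) (J U μ p : ℝ)
    (Z : Finset Λ) : IsSectorHermitian (hamiltonian Λ J U μ p Z) := by
  classical
  refine IsSectorHermitian.add
    ⟨PreservesSectors.sum _ fun x _ => PreservesSectors.sum _ fun y _ => ?_, fun m n => ?_⟩ (IsSectorHermitian.sum _ fun x _ => IsSectorHermitian.sum _ fun y _ => ?_)
  · split_ifs
    · exact PreservesSectors.smul _ (PreservesSectors.creat_annih x y)
    · exact PreservesSectors.zero
  · simp only [elt_sum, star_sum]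
    rw [Finset.sum_comm]
    refine Finset.sum_congr rfl fun x _ => Finset.sum_congr rfl fun y _ => ?_
    have hc : latticeDist y.1 x.1 = latticeDist x.1 y.1 := by
      unfold latticeDist
      congr 1
      exact Finset.sum_congr rfl fun i _ => by ring
    rw [hc]
    split_ifs
    · rw [hop, hop, elt_smul, elt_smul, star_mul', elt_creat_annih_symm y x]
      simp
    · simp [elt]
  · split_ifs
    · rw [pot_eq_diag]
      exact IsSectorHermitian.diag _
    · exact IsSectorHermitian.zero

theorem IsSectorHermitian.barFormal {K : FormalOp S} (hK : IsSectorHermitian K) (Y : Finset S)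
    (ν : ℝ) : IsSectorHermitian (barFormal Y ν K) := by
  have hs : ∀ n : S → ℕ, BoseHubbard.diag (cutoff Y ν) (Pi.single n (1 : ℂ)) =
      (cutoff Y ν n : ℂ) • Pi.single n (1 : ℂ) := by
    intro n
    funext k
    by_cases h : k = n
    · subst h; simp [diag_apply]
    · simp [diag_apply, h]
  have he : ∀ m n, elt (BoseHubbard.barFormal Y ν K) m n =
      (cutoff Y ν m : ℂ) * ((cutoff Y ν n : ℂ) * elt K m n) := by
    intro m n
    simp only [elt, BoseHubbard.barFormal, truncFormal, Module.End.mul_apply, diag_apply]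
    rw [hs, map_smul]
    rfl
  refine ⟨fun f m => ?_, fun m n => ?_⟩
  · simp only [he]
    simp only [BoseHubbard.barFormal, truncFormal, Module.End.mul_apply, diag_apply]
    rw [hK.apply_eq, Finset.mul_sum]
    refine Finset.sum_congr rfl fun n _ => ?_
    rw [diag_apply]
    ring
  · rw [he, he, hK.herm m n]
    simp
    ring

end Hermitian

/-! ### The truncated dynamics -/

/-- The dynamics `A ↦ e^{itH̄_Z} A e^{-itH̄_Z}` generated by `H̄_Z = Π H_Z Π`, `Π = Π_{Y,ν}`. -/
def truncDynamics {d : ℕ} (Λ : Finset (Fin d → ℤ)) (J U μ p : ℝ) (Y : Finset Λ) (ν : ℝ)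
    (Z : Finset Λ) (t : ℝ) (A : Fock Λ →L[ℂ] Fock Λ) : Fock Λ →L[ℂ] Fock Λ :=
  heisenberg (barFormal Y ν (hamiltonian Λ J U μ p Z))
    ((IsSectorHermitian.hamiltonian Λ J U μ p Z).barFormal Y ν) t A

end BoseHubbard

end

open BoseHubbard

/-! Particle number is conserved, so every operator involved is a direct sum over the
finite-dimensional sectors of fixed `N`. It therefore suffices to work in the C⋆-algebra of matrices
on one sector, with constants independent of `N` (`HasBlocks.norm_le`). Two things could spoil
uniform constants: the interaction is arbitrarily large, and hopping outside `X[R+2]` is not cut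
off, so its norm grows with `N`.

The interaction terms are diagonal and commute with each other. In the interaction picture, a
hopping term is conjugated only by the interaction terms that meet its pair
(`commute_conjDyn_hopMat`). It keeps its norm, at most `|J| ν` inside `X[R+2]`, and its support
grows only to neighbouring sites. A Lieb–Robinson iteration then gives a commutator bound that does
not see `U`, `μ`, `p` (`LocalDynamics.norm_lie_conjDyn_le`). A weight decaying exponentially with
the distance from `X` supplies the factor `e^{-R}`.

Both dynamics are compared with a third one, with hopping in `X[R-1]` and interaction in `X[R]`
(`norm_conjDyn_block_sub_le`). What this generator lacks consists of hopping terms that touch `X[R]`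
but leave `X[R-1]`, hopping terms disjoint from `X[R]`, and interaction terms not inside `X[R]`. The
last two kinds may be huge, but they commute with the third generator and with the observable, so
they drop out of Duhamel's formula (`LocalDynamics.norm_conjDyn_sub_le`). The first kind lies inside
`X[R+2]`, is bounded by `|J| ν`, and has of order `|X| R^d` members.

Locality survives the truncation because `Π` is a product of one-site projections: truncated
operators with disjoint supports still commute (`commute_truncMat`). -/

noncomputable section

namespace BoseHubbard

/-! ### Heisenberg dynamics and a Lieb–Robinson bound in a C⋆-algebra -/

section CStar

variable {𝒜 : Type*} [CStarAlgebra 𝒜]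

/-- The one-parameter group `e^{itH}`. -/
def propagator (H : 𝒜) (t : ℝ) : 𝒜 := NormedSpace.exp ((Complex.I * t) • H)

/-- The dynamics `a ↦ e^{itH} a e^{-itH}`. -/
def conjDyn (H : 𝒜) (t : ℝ) (a : 𝒜) : 𝒜 := propagator H t * a * propagator H (-t)

theorem propagator_eq (H : 𝒜) (t : ℝ) :
    propagator H t = NormedSpace.exp (t • (Complex.I • H)) := by
  rw [propagator, mul_comm, mul_smul]; rfl

@[simp] theorem propagator_zero (H : 𝒜) : propagator H 0 = 1 := by
  simp [propagator]

theorem propagator_add (H : 𝒜) (s t : ℝ) :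
    propagator H (s + t) = propagator H s * propagator H t := by
  let _ : NormedAlgebra ℚ 𝒜 := NormedAlgebra.restrictScalars ℚ ℂ 𝒜
  rw [propagator_eq, propagator_eq, propagator_eq, add_smul, NormedSpace.exp_add_of_commute]
  exact ((Commute.refl _).smul_left _).smul_right _

theorem propagator_mul_neg (H : 𝒜) (t : ℝ) : propagator H t * propagator H (-t) = 1 := by
  rw [← propagator_add, add_neg_cancel, propagator_zero]

theorem propagator_neg_mul (H : 𝒜) (t : ℝ) : propagator H (-t) * propagator H t = 1 := by
  rw [← propagator_add, neg_add_cancel, propagator_zero]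

theorem propagator_neg_neg (H : 𝒜) (t : ℝ) : propagator (-H) (-t) = propagator H t := by
  simp [propagator]

theorem propagator_mem_unitary {H : 𝒜} (hH : IsSelfAdjoint H) (t : ℝ) :
    propagator H t ∈ unitary 𝒜 := by
  let _ : NormedAlgebra ℚ 𝒜 := NormedAlgebra.restrictScalars ℚ ℂ 𝒜
  refine NormedSpace.exp_mem_unitary_of_mem_skewAdjoint ?_
  rw [skewAdjoint.mem_iff, star_smul, hH.star_eq]
  simp

theorem hasDerivAt_propagator (H : 𝒜) (t : ℝ) :
    HasDerivAt (propagator H) (propagator H t * (Complex.I • H)) t := by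
  have h := hasDerivAt_exp_smul_const (𝕂 := ℝ) (Complex.I • H) t
  rw [← propagator_eq] at h
  exact h.congr_of_eventuallyEq (Filter.Eventually.of_forall fun s => propagator_eq H s)

theorem commute_propagator {H a : 𝒜} (h : Commute a H) (t : ℝ) : Commute a (propagator H t) := by
  refine Commute.exp_right ?_
  exact h.smul_right _

theorem propagator_add_of_commute {H K : 𝒜} (h : Commute H K) (t : ℝ) :
    propagator (H + K) t = propagator H t * propagator K t := by
  let _ : NormedAlgebra ℚ 𝒜 := NormedAlgebra.restrictScalars ℚ ℂ 𝒜
  rw [propagator, smul_add, NormedSpace.exp_add_of_commute, propagator, propagator]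
  exact (h.smul_left _).smul_right _

theorem hasDerivAt_propagator_const_sub (H : 𝒜) (u s : ℝ) :
    HasDerivAt (fun s => propagator H (u - s)) (-((Complex.I • H) * propagator H (u - s))) s := by
  have h := (hasDerivAt_propagator H (u - s)).scomp s ((hasDerivAt_id s).const_sub u)
  have hc : Commute (Complex.I • H) (propagator H (u - s)) :=
    commute_propagator ((Commute.refl H).smul_left _) _
  rw [neg_one_smul, ← hc.eq] at h
  exact h

theorem hasDerivAt_propagator_sub_const (H : 𝒜) (u s : ℝ) :
    HasDerivAt (fun s => propagator H (s - u)) (propagator H (s - u) * (Complex.I • H)) s := by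
  have h := (hasDerivAt_propagator H (s - u)).scomp s ((hasDerivAt_id s).sub_const u)
  rw [one_smul] at h
  exact h

@[simp] theorem conjDyn_zero (H a : 𝒜) : conjDyn H 0 a = a := by simp [conjDyn]

theorem conjDyn_neg_neg (H a : 𝒜) (t : ℝ) : conjDyn (-H) (-t) a = conjDyn H t a := by
  rw [conjDyn, propagator_neg_neg, propagator_neg_neg, conjDyn]

theorem conjDyn_mul (H : 𝒜) (t : ℝ) (a b : 𝒜) :
    conjDyn H t (a * b) = conjDyn H t a * conjDyn H t b := by
  have h := propagator_neg_mul H t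
  calc conjDyn H t (a * b)
      = propagator H t * a * 1 * b * propagator H (-t) := by simp only [conjDyn]; noncomm_ring
    _ = _ := by rw [← h]; simp only [conjDyn]; noncomm_ring

theorem conjDyn_sub (H : 𝒜) (t : ℝ) (a b : 𝒜) :
    conjDyn H t (a - b) = conjDyn H t a - conjDyn H t b := by
  simp only [conjDyn]; noncomm_ring

theorem conjDyn_smul (H : 𝒜) (t : ℝ) (c : ℂ) (a : 𝒜) :
    conjDyn H t (c • a) = c • conjDyn H t a := by
  simp [conjDyn]

theorem conjDyn_sum {ι : Type*} (s : Finset ι) (H : 𝒜) (t : ℝ) (a : ι → 𝒜) :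
    conjDyn H t (∑ i ∈ s, a i) = ∑ i ∈ s, conjDyn H t (a i) := by
  simp [conjDyn, Finset.mul_sum, Finset.sum_mul]

theorem conjDyn_lie (H : 𝒜) (t : ℝ) (a b : 𝒜) :
    conjDyn H t ⁅a, b⁆ = ⁅conjDyn H t a, conjDyn H t b⁆ := by
  rw [Ring.lie_def, Ring.lie_def, conjDyn_sub, conjDyn_mul, conjDyn_mul]

theorem conjDyn_conjDyn (H : 𝒜) (s t : ℝ) (a : 𝒜) :
    conjDyn H s (conjDyn H t a) = conjDyn H (s + t) a := by
  rw [conjDyn, conjDyn, conjDyn, propagator_add, neg_add_rev, propagator_add]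
  noncomm_ring

theorem norm_conjDyn {H : 𝒜} (hH : IsSelfAdjoint H) (t : ℝ) (a : 𝒜) : ‖conjDyn H t a‖ = ‖a‖ := by
  rw [conjDyn, CStarRing.norm_mul_mem_unitary _ (propagator_mem_unitary hH _),
    CStarRing.norm_mem_unitary_mul _ (propagator_mem_unitary hH _)]

theorem commute_conjDyn {H a b : 𝒜} (hH : Commute a H) (hb : Commute a b) (t : ℝ) :
    Commute a (conjDyn H t b) :=
  ((commute_propagator hH t).mul_right hb).mul_right (commute_propagator hH (-t))

theorem conjDyn_of_commute {H a : 𝒜} (h : Commute a H) (t : ℝ) : conjDyn H t a = a := by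
  rw [conjDyn, ← (commute_propagator h t).eq, mul_assoc, propagator_mul_neg, mul_one]

/-- A part of the generator that commutes with the rest and with the observable does not matter. -/
theorem conjDyn_add_of_commute {H W a : 𝒜} (hH : Commute W H) (ha : Commute a W) (t : ℝ) :
    conjDyn (H + W) t a = conjDyn H t a := by
  have h : conjDyn (H + W) t a = conjDyn H t (conjDyn W t a) := by
    rw [conjDyn, propagator_add_of_commute hH.symm, add_comm H W, propagator_add_of_commute hH,
      conjDyn, conjDyn]
    noncomm_ring
  rw [h, conjDyn_of_commute ha]

/-- The derivative in Duhamel's formula. -/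
theorem hasDerivAt_conjDyn_conjDyn (H K a : 𝒜) (u s : ℝ) :
    HasDerivAt (fun s => conjDyn H s (conjDyn K (u - s) a))
      (conjDyn H s (Complex.I • ⁅H - K, conjDyn K (u - s) a⁆)) s := by
  have h1 := hasDerivAt_propagator H s
  have h2 := hasDerivAt_propagator_const_sub K u s
  have h3 : HasDerivAt (fun s => propagator K (-(u - s)))
      (propagator K (-(u - s)) * (Complex.I • K)) s := by
    simpa using hasDerivAt_propagator_sub_const K u s
  have h4 : HasDerivAt (fun s => propagator H (-s)) (-((Complex.I • H) * propagator H (-s))) s := by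
    simpa using hasDerivAt_propagator_const_sub H 0 s
  have h5 := (h1.mul ((h2.mul_const a).mul h3)).mul h4
  refine h5.congr_deriv ?_
  rw [conjDyn_smul, conjDyn, Ring.lie_def, conjDyn]
  simp only [mul_smul_comm, smul_mul_assoc, ← smul_neg, ← smul_add, Pi.mul_apply]
  congr 1
  noncomm_ring

/-! ### Commutator estimates and the abstract form of a local dynamics. -/

theorem norm_lie_le (a b : 𝒜) : ‖⁅a, b⁆‖ ≤ 2 * ‖a‖ * ‖b‖ := by
  rw [Ring.lie_def]
  refine (norm_sub_le _ _).trans ?_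
  have h1 := norm_mul_le a b
  have h2 := norm_mul_le b a
  linarith

theorem sum_lie_right {ι : Type*} (s : Finset ι) (a : ι → 𝒜) (b : 𝒜) :
    ⁅∑ i ∈ s, a i, b⁆ = ∑ i ∈ s, ⁅a i, b⁆ := by
  simp only [Ring.lie_def, Finset.sum_mul, Finset.mul_sum, ← Finset.sum_sub_distrib]

/-- The Jacobi identity. It trades a nested commutator for single commutators with `c`, which is
what lets the Lieb–Robinson estimate close on itself. -/
theorem norm_lie_lie_le (a b c : 𝒜) :
    ‖⁅⁅a, b⁆, c⁆‖ ≤ 2 * ‖a‖ * ‖⁅b, c⁆‖ + 2 * ‖b‖ * ‖⁅a, c⁆‖ := by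
  have h : ⁅⁅a, b⁆, c⁆ = ⁅a, ⁅b, c⁆⁆ - ⁅b, ⁅a, c⁆⁆ := by
    simp only [Ring.lie_def]; noncomm_ring
  rw [h]
  refine (norm_sub_le _ _).trans (add_le_add (norm_lie_le _ _) (norm_lie_le _ _))

theorem norm_I_smul (a : 𝒜) : ‖Complex.I • a‖ = ‖a‖ := by
  rw [norm_smul, Complex.norm_I, one_mul]

/-- The hypotheses of the Lieb–Robinson bound: the generator is `H = V + ∑_{f ∈ F} h_f`, where the
terms `h_e`, `e ∈ G ⊇ F`, are bounded by `g`, have at most `D` neighbours in `F` when evolved with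
the arbitrarily large `V`, and carry a weight that varies slowly from neighbour to neighbour and is
at least one where the evolved `h_e` does not commute with the observable. -/
structure LocalDynamics {E : Type*} (H V A : 𝒜) (h : E → 𝒜) (F : Finset E) (G : Set E)
    (N : E → Finset E) (w : E → ℝ) (g κ D : ℝ) : Prop where
  selfAdjoint : IsSelfAdjoint H
  selfAdjoint_free : IsSelfAdjoint V
  sub_eq : H - V = ∑ f ∈ F, h f
  subset : ∀ f ∈ F, f ∈ G
  norm_le : ∀ e ∈ G, ‖h e‖ ≤ g
  weight_pos : ∀ e, 0 < w e
  card_le : ∀ e ∈ G, ((N e).card : ℝ) ≤ D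
  weight_le : ∀ e ∈ G, ∀ f ∈ N e, w f ≤ κ * w e
  commute : ∀ e ∈ G, ∀ f ∈ F, f ∉ N e → ∀ r, Commute (h f) (conjDyn V r (h e))
  commute_observable : ∀ e ∈ G, w e < 1 → ∀ r, Commute (conjDyn V r (h e)) A

/-! ### The Lieb–Robinson iteration and the comparison of two dynamics. -/

namespace LocalDynamics

variable {E : Type*} {H V A : 𝒜} {h : E → 𝒜} {F : Finset E} {G : Set E}
  {N : E → Finset E} {w : E → ℝ} {g κ D : ℝ}

/-- Time reversal: running the negated generator for time `-t` is the original dynamics. This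
reduces negative times to positive ones. -/
theorem neg (L : LocalDynamics H V A h F G N w g κ D) :
    LocalDynamics (-H) (-V) A (-h) F G N w g κ D where
  selfAdjoint := L.selfAdjoint.neg
  selfAdjoint_free := L.selfAdjoint_free.neg
  sub_eq := by
    simp only [Pi.neg_apply, Finset.sum_neg_distrib, ← L.sub_eq]
    noncomm_ring
  subset := L.subset
  norm_le e he := by simpa using L.norm_le e he
  weight_pos := L.weight_pos
  card_le := L.card_le
  weight_le := L.weight_le
  commute e he f hf hfe r := by
    have h1 := L.commute e he f hf hfe (-r)
    rw [← conjDyn_neg_neg, neg_neg] at h1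
    have h2 : conjDyn (-V) r ((-h) e) = -conjDyn (-V) r (h e) := by simp [conjDyn]
    rw [h2]
    exact h1.neg_left.neg_right
  commute_observable e he hw r := by
    have h1 := L.commute_observable e he hw (-r)
    rw [← conjDyn_neg_neg, neg_neg] at h1
    have h2 : conjDyn (-V) r ((-h) e) = -conjDyn (-V) r (h e) := by simp [conjDyn]
    rw [h2]
    exact h1.neg_left

/-- One step of the Lieb–Robinson iteration. -/
theorem bound_step (L : LocalDynamics H V A h F G N w g κ D) (hg : 0 ≤ g) (hκ : 0 ≤ κ)
    {t M : ℝ} (hM : 0 ≤ M)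
    (hb : ∀ e ∈ G, ∀ u, ∀ s ∈ Set.Icc 0 t, ‖⁅conjDyn H s (conjDyn V u (h e)), conjDyn H t A⁆‖ ≤
      M * w e * Real.exp (4 * g * D * (1 + κ) * (t - s))) :
    ∀ e ∈ G, ∀ u, ∀ s ∈ Set.Icc 0 t, ‖⁅conjDyn H s (conjDyn V u (h e)), conjDyn H t A⁆‖ ≤
      (2 * g * ‖A‖ + M / 2) * w e * Real.exp (4 * g * D * (1 + κ) * (t - s)) := by
  classical
  intro e he u s hs
  have hwe := L.weight_pos e
  have hD : 0 ≤ D := (Nat.cast_nonneg _).trans (L.card_le e he)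
  -- The rate is twice the factor `2 g D (1 + κ)` that appears in the derivative bound. Integrating
  -- the exponential thus turns the assumed constant `M` into `M / 2`.
  set lam := 4 * g * D * (1 + κ) with hlam
  have hlam0 : 0 ≤ lam := by positivity
  set O := conjDyn H t A with hO
  -- The full evolution is traded for free evolution at fixed total time `u + s`. Only `H - V`
  -- enters the derivative, so the size of `V` is irrelevant. The free time varies along the path,
  -- hence the quantification over all `u` in the hypothesis.
  set f : ℝ → 𝒜 := fun r => ⁅conjDyn H (t - r) (conjDyn V (u + s - (t - r)) (h e)), O⁆ with hf
  set f' : ℝ → 𝒜 := fun r =>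
    -⁅conjDyn H (t - r) (Complex.I • ⁅H - V, conjDyn V (u + s - (t - r)) (h e)⁆), O⁆ with hf'
  have hder : ∀ r, HasDerivAt f (f' r) r := by
    intro r
    have h1 := (hasDerivAt_conjDyn_conjDyn H V (h e) (u + s) (t - r)).scomp r
      ((hasDerivAt_id r).const_sub t)
    have h2 := (h1.mul_const O).sub (h1.const_mul O)
    refine h2.congr_deriv ?_
    simp only [hf', Ring.lie_def, neg_one_smul]
    noncomm_ring
  have key := image_norm_le_of_norm_deriv_right_le_deriv_boundary (f := f) (f' := f') (a := 0)
    (b := t - s) (fun r _ => (hder r).continuousAt.continuousWithinAt)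
    (fun r _ => (hder r).hasDerivWithinAt)
    (B := fun r => w e * (2 * g * ‖A‖ + M / 2 * Real.exp (lam * r)))
    (B' := fun r => w e * (M / 2 * (Real.exp (lam * r) * lam))) ?_ ?_ ?_
    (x := t - s) ⟨by linarith [hs.2], le_rfl⟩
  · have h1 : f (t - s) = ⁅conjDyn H s (conjDyn V u (h e)), O⁆ := by
      simp only [hf]
      congr 3 <;> ring_nf
    rw [h1] at key
    refine key.trans ?_
    have h2 : 1 ≤ Real.exp (lam * (t - s)) :=
      Real.one_le_exp (mul_nonneg hlam0 (by linarith [hs.2]))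
    have h3 : 0 ≤ 2 * g * ‖A‖ := by positivity
    nlinarith [mul_le_mul_of_nonneg_left h2 (mul_nonneg hwe.le h3)]
  · have h1 : f 0 = conjDyn H t ⁅conjDyn V (u + s - t) (h e), A⁆ := by
      simp only [hf, hO, sub_zero, conjDyn_lie]
    rw [h1, norm_conjDyn L.selfAdjoint]
    -- At `r = 0` the commutator either vanishes or is paid for by a weight at least one.
    by_cases hw : w e < 1
    · rw [(L.commute_observable e he hw _).lie_eq, norm_zero]
      positivity
    · refine (norm_lie_le _ _).trans ?_
      rw [norm_conjDyn L.selfAdjoint_free]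
      have h2 : 2 * ‖h e‖ * ‖A‖ ≤ 2 * g * ‖A‖ := by gcongr; exact L.norm_le e he
      have h3 : 0 ≤ 2 * g * ‖A‖ := by positivity
      have h4 : 0 ≤ w e * (M / 2 * Real.exp (lam * 0)) := by positivity
      nlinarith [mul_le_mul_of_nonneg_right (not_lt.1 hw) h3]
  · intro r
    have h1 : HasDerivAt (fun r : ℝ => Real.exp (lam * r)) (Real.exp (lam * r) * lam) r := by
      simpa using ((hasDerivAt_id r).const_mul lam).exp
    exact ((h1.const_mul (M / 2)).const_add _).const_mul _
  · intro r hr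
    have hr' : t - r ∈ Set.Icc 0 t := ⟨by linarith [hr.2, hs.1], by linarith [hr.1]⟩
    set b := conjDyn V (u + s - (t - r)) (h e) with hbdef
    have h1 : ⁅H - V, b⁆ = ∑ k ∈ F with k ∈ N e, ⁅h k, b⁆ := by
      rw [L.sub_eq, sum_lie_right, Finset.sum_filter]
      refine Finset.sum_congr rfl fun k hk => ?_
      split_ifs with hkN
      · rfl
      · exact (L.commute e he k hk hkN _).lie_eq
    have h2 : f' r = -(Complex.I • ∑ k ∈ F with k ∈ N e,
        ⁅⁅conjDyn H (t - r) (h k), conjDyn H (t - r) b⁆, O⁆) := by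
      simp only [hf', ← hbdef, h1]
      rw [conjDyn_smul, Ring.lie_def, smul_mul_assoc, mul_smul_comm, ← smul_sub, ← Ring.lie_def,
        conjDyn_sum, sum_lie_right]
      simp only [conjDyn_lie]
    rw [h2, norm_neg, norm_I_smul]
    have h3 : ∀ k ∈ F.filter (· ∈ N e),
        ‖⁅⁅conjDyn H (t - r) (h k), conjDyn H (t - r) b⁆, O⁆‖ ≤
          2 * g * (1 + κ) * (M * w e * Real.exp (lam * r)) := by
      intro k hk
      obtain ⟨hkF, hkN⟩ := Finset.mem_filter.1 hk
      have hkG := L.subset k hkF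
      refine (norm_lie_lie_le _ _ _).trans ?_
      -- The hypothesis is used twice: for `e` at its current free time, and for the neighbour `k`
      -- at free time zero.
      have e1 := hb e he (u + s - (t - r)) (t - r) hr'
      have e2 := hb k hkG 0 (t - r) hr'
      rw [conjDyn_zero] at e2
      rw [sub_sub_cancel] at e1 e2
      have e3 : ‖conjDyn H (t - r) (h k)‖ ≤ g := by
        rw [norm_conjDyn L.selfAdjoint]; exact L.norm_le k hkG
      have e4 : ‖conjDyn H (t - r) b‖ ≤ g := by
        rw [norm_conjDyn L.selfAdjoint, hbdef, norm_conjDyn L.selfAdjoint_free]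
        exact L.norm_le e he
      have e5 : M * w k * Real.exp (lam * r) ≤ κ * (M * w e * Real.exp (lam * r)) := by
        have := mul_le_mul_of_nonneg_left (L.weight_le e he k hkN)
          (mul_nonneg hM (Real.exp_pos (lam * r)).le)
        linarith
      calc 2 * ‖conjDyn H (t - r) (h k)‖ * ‖⁅conjDyn H (t - r) b, O⁆‖ +
            2 * ‖conjDyn H (t - r) b‖ * ‖⁅conjDyn H (t - r) (h k), O⁆‖
          ≤ 2 * g * (M * w e * Real.exp (lam * r)) +
            2 * g * (κ * (M * w e * Real.exp (lam * r))) := by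
            gcongr
            exact e2.trans e5
        _ = _ := by ring
    refine (norm_sum_le _ _).trans ((Finset.sum_le_card_nsmul _ _ _ h3).trans ?_)
    rw [nsmul_eq_mul]
    have h4 : (((F.filter (· ∈ N e)).card : ℕ) : ℝ) ≤ D := by
      refine le_trans ?_ (L.card_le e he)
      exact_mod_cast Finset.card_le_card fun k hk => (Finset.mem_filter.1 hk).2
    calc _ ≤ D * (2 * g * (1 + κ) * (M * w e * Real.exp (lam * r))) := by gcongr
      _ = _ := by rw [hlam]; ring

/-- The Lieb–Robinson bound. Its constants do not depend on `V`. -/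
theorem norm_lie_conjDyn_le [Finite E] (L : LocalDynamics H V A h F G N w g κ D) (hg : 0 ≤ g)
    (hκ : 0 ≤ κ) (hD : 0 ≤ D) {t : ℝ} :
    ∀ e ∈ G, ∀ u, ∀ s ∈ Set.Icc 0 t, ‖⁅conjDyn H s (conjDyn V u (h e)), conjDyn H t A⁆‖ ≤
      4 * g * ‖A‖ * w e * Real.exp (4 * g * D * (1 + κ) * (t - s)) := by
  -- Finiteness of `E` gives a crude starting constant. It leaves no trace, since each step halves
  -- its excess over the fixed point `4 g ‖A‖` of `M ↦ 2 g ‖A‖ + M / 2`.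
  obtain ⟨c, hc⟩ : ∃ c, ∀ e, (w e)⁻¹ ≤ c := by
    obtain ⟨c, hc⟩ := (Set.finite_range fun e => (w e)⁻¹).bddAbove
    exact ⟨c, fun e => hc ⟨e, rfl⟩⟩
  have hlam : 0 ≤ 4 * g * D * (1 + κ) := by positivity
  have hK : 0 ≤ 2 * g * ‖A‖ := by positivity
  set M₀ := 2 * g * ‖A‖ * max c 0 with hM₀
  have hM₀' : 0 ≤ M₀ := mul_nonneg hK (le_max_right _ _)
  have step : ∀ k : ℕ, ∀ e ∈ G, ∀ u, ∀ s ∈ Set.Icc 0 t,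
      ‖⁅conjDyn H s (conjDyn V u (h e)), conjDyn H t A⁆‖ ≤
      (4 * g * ‖A‖ + M₀ * (1 / 2) ^ k) * w e * Real.exp (4 * g * D * (1 + κ) * (t - s)) := by
    intro k
    induction k with
    | zero =>
      intro e he u s hs
      have hwe := L.weight_pos e
      have h1 : 1 ≤ max c 0 * w e := by
        have := mul_le_mul_of_nonneg_right ((hc e).trans (le_max_left c 0)) hwe.le
        rwa [inv_mul_cancel₀ hwe.ne'] at this
      have h2 : 1 ≤ Real.exp (4 * g * D * (1 + κ) * (t - s)) :=
        Real.one_le_exp (mul_nonneg hlam (by linarith [hs.2]))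
      have h3 : ‖⁅conjDyn H s (conjDyn V u (h e)), conjDyn H t A⁆‖ ≤ 2 * g * ‖A‖ := by
        refine (norm_lie_le _ _).trans ?_
        rw [norm_conjDyn L.selfAdjoint, norm_conjDyn L.selfAdjoint_free,
          norm_conjDyn L.selfAdjoint]
        gcongr
        exact L.norm_le e he
      calc _ ≤ 2 * g * ‖A‖ := h3
        _ ≤ 2 * g * ‖A‖ * (max c 0 * w e) := le_mul_of_one_le_right hK h1
        _ ≤ (4 * g * ‖A‖ + M₀ * (1 / 2) ^ 0) * w e := by
          rw [hM₀]
          nlinarith [mul_nonneg hK hwe.le]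
        _ ≤ _ := le_mul_of_one_le_right (by positivity) h2
    | succ k ih =>
      intro e he u s hs
      refine (L.bound_step hg hκ (by positivity) ih e he u s hs).trans (le_of_eq ?_)
      rw [pow_succ]
      ring
  intro e he u s hs
  have hlim : Filter.Tendsto (fun k : ℕ => (4 * g * ‖A‖ + M₀ * (1 / 2) ^ k) * w e *
      Real.exp (4 * g * D * (1 + κ) * (t - s))) Filter.atTop
      (nhds ((4 * g * ‖A‖ + M₀ * 0) * w e * Real.exp (4 * g * D * (1 + κ) * (t - s)))) :=
    ((((tendsto_pow_atTop_nhds_zero_of_lt_one (by norm_num) (by norm_num)).const_mul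
      M₀).const_add _).mul_const _).mul_const _
  rw [mul_zero, add_zero] at hlim
  exact ge_of_tendsto' hlim fun k => step k e he u s hs

/-- Duhamel's formula, in differential form: the derivative of the interpolation contains the
commutator of `K - H` with the evolved observable. The parts `Q` and `W` commute with the latter
whatever their size, and each term of `P` obeys the Lieb–Robinson bound. -/
theorem norm_conjDyn_sub_le_of_nonneg [Finite E] (L : LocalDynamics H V A h F G N w g κ D)
    (hg : 0 ≤ g) (hκ : 0 ≤ κ) (hD : 1 ≤ D) {K W : 𝒜} (hK : IsSelfAdjoint K) (P Q : Finset E)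
    (hKH : K - H = ∑ e ∈ P, h e + ∑ e ∈ Q, h e + W) (hPG : ∀ e ∈ P, e ∈ G)
    (hQ : ∀ e ∈ Q, ∀ r, Commute (h e) (conjDyn H r A))
    (hW : ∀ r, Commute W (conjDyn H r A)) {ε : ℝ} (hε : ∀ e ∈ P, w e ≤ ε) {t : ℝ} (ht : 0 ≤ t) :
    ‖conjDyn K t A - conjDyn H t A‖ ≤
      P.card * ‖A‖ * ε * (Real.exp (4 * g * D * (1 + κ) * t) - 1) := by
  have hD0 : 0 ≤ D := by linarith
  set lam := 4 * g * D * (1 + κ) with hlam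
  have hlam0 : 0 ≤ lam := by positivity
  -- If `P` is empty, the sign of `ε` is unknown, but then the interpolation is constant and the two
  -- dynamics agree on `A`.
  rcases P.eq_empty_or_nonempty with rfl | ⟨e₀, he₀⟩
  · have hcom : ∀ r, Commute (K - H) (conjDyn H r A) := by
      intro r
      rw [hKH, Finset.sum_empty, zero_add]
      exact (Commute.sum_left _ _ _ fun e he => hQ e he r).add_left (hW r)
    have hder : ∀ s, HasDerivAt (fun s => conjDyn K s (conjDyn H (t - s) A)) 0 s := by
      intro s
      have h1 := hasDerivAt_conjDyn_conjDyn K H A t s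
      rw [(hcom _).lie_eq, smul_zero] at h1
      refine h1.congr_deriv ?_
      simp [conjDyn]
    have h2 := is_const_of_deriv_eq_zero (fun s => (hder s).differentiableAt)
      (fun s => (hder s).deriv) t 0
    simp only [sub_self, conjDyn_zero, sub_zero] at h2
    rw [h2]
    simp
  have hε0 : 0 ≤ ε := (L.weight_pos e₀).le.trans (hε e₀ he₀)
  set f : ℝ → 𝒜 := fun s => conjDyn K s (conjDyn H (t - s) A) - conjDyn H t A with hf
  set f' : ℝ → 𝒜 := fun s => conjDyn K s (Complex.I • ⁅K - H, conjDyn H (t - s) A⁆) with hf'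
  have hder : ∀ s, HasDerivAt f (f' s) s := fun s =>
    (hasDerivAt_conjDyn_conjDyn K H A t s).sub_const _
  set c := P.card * ‖A‖ * ε with hc
  have hc0 : 0 ≤ c := by positivity
  have key := image_norm_le_of_norm_deriv_right_le_deriv_boundary (f := f) (f' := f') (a := 0)
    (b := t) (fun r _ => (hder r).continuousAt.continuousWithinAt)
    (fun r _ => (hder r).hasDerivWithinAt)
    (B := fun s => c * (Real.exp (lam * t) - Real.exp (lam * (t - s))))
    (B' := fun s => c * (Real.exp (lam * (t - s)) * lam)) ?_ ?_ ?_
    (x := t) ⟨ht, le_rfl⟩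
  · simpa [hf] using key
  · simp [hf]
  · intro s
    have h1 : HasDerivAt (fun s : ℝ => Real.exp (lam * (t - s)))
        (Real.exp (lam * (t - s)) * (lam * -1)) s :=
      (((hasDerivAt_id s).const_sub t).const_mul lam).exp
    refine ((h1.const_sub _).const_mul c).congr_deriv ?_
    ring
  · intro s hs
    have h1 : ⁅K - H, conjDyn H (t - s) A⁆ = ∑ e ∈ P, ⁅h e, conjDyn H (t - s) A⁆ := by
      have h2 := (Commute.sum_left _ _ _ fun e he => hQ e he (t - s)).add_left (hW (t - s))
      rw [hKH, add_assoc, ← sum_lie_right, Ring.lie_def, add_mul, mul_add, h2.eq, Ring.lie_def]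
      abel
    have h4 : ∀ e ∈ P, ‖⁅h e, conjDyn H (t - s) A⁆‖ ≤
        4 * g * ‖A‖ * ε * Real.exp (lam * (t - s)) := by
      intro e he
      have h5 := L.norm_lie_conjDyn_le hg hκ hD0 (t := t) e (hPG e he) 0 s ⟨hs.1, hs.2.le⟩
      have h6 : ⁅conjDyn H s (h e), conjDyn H t A⁆ = conjDyn H s ⁅h e, conjDyn H (t - s) A⁆ := by
        rw [conjDyn_lie, conjDyn_conjDyn, add_sub_cancel]
      rw [conjDyn_zero, h6, norm_conjDyn L.selfAdjoint] at h5
      refine h5.trans ?_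
      gcongr
      exact hε e he
    simp only [hf']
    rw [norm_conjDyn hK, norm_I_smul, h1]
    refine (norm_sum_le _ _).trans ((Finset.sum_le_card_nsmul _ _ _ h4).trans ?_)
    rw [nsmul_eq_mul]
    -- This absorbs the Lieb–Robinson prefactor `4 g` into the derivative of the exponential; it is
    -- where `1 ≤ D` enters.
    have h7 : 4 * g ≤ lam := by
      have : 1 ≤ D * (1 + κ) := by nlinarith
      rw [hlam, mul_assoc]
      exact le_mul_of_one_le_right (by positivity) this
    calc _ = c * (Real.exp (lam * (t - s)) * (4 * g)) := by rw [hc]; ring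
      _ ≤ _ := by gcongr

/-- Adding to the generator of a local dynamics terms `h_e` far from the observable changes the
evolved observable little. -/
theorem norm_conjDyn_sub_le [Finite E] (L : LocalDynamics H V A h F G N w g κ D)
    (hg : 0 ≤ g) (hκ : 0 ≤ κ) (hD : 1 ≤ D) {K W : 𝒜} (hK : IsSelfAdjoint K) (P Q : Finset E)
    (hKH : K - H = ∑ e ∈ P, h e + ∑ e ∈ Q, h e + W) (hPG : ∀ e ∈ P, e ∈ G)
    (hQ : ∀ e ∈ Q, ∀ r, Commute (h e) (conjDyn H r A))
    (hW : ∀ r, Commute W (conjDyn H r A)) {ε : ℝ} (hε : ∀ e ∈ P, w e ≤ ε) (t : ℝ) :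
    ‖conjDyn K t A - conjDyn H t A‖ ≤
      P.card * ‖A‖ * ε * (Real.exp (4 * g * D * (1 + κ) * |t|) - 1) := by
  rcases le_total 0 t with ht | ht
  · rw [abs_of_nonneg ht]
    exact L.norm_conjDyn_sub_le_of_nonneg hg hκ hD hK P Q hKH hPG hQ hW hε ht
  · rw [abs_of_nonpos ht, ← conjDyn_neg_neg K, ← conjDyn_neg_neg H]
    refine L.neg.norm_conjDyn_sub_le_of_nonneg (W := -W) hg hκ hD hK.neg P Q ?_ hPG ?_ ?_ hε
      (neg_nonneg.2 ht)
    · simp only [Pi.neg_apply, Finset.sum_neg_distrib]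
      rw [neg_sub_neg, ← neg_sub, hKH]
      abel
    · intro e he r
      rw [← neg_neg r, conjDyn_neg_neg]
      exact (hQ e he _).neg_left
    · intro r
      rw [← neg_neg r, conjDyn_neg_neg]
      exact (hW _).neg_left

end LocalDynamics

end CStar

/-! ### Operator norms of matrices. -/

section MatrixNorm

open scoped Matrix.Norms.L2Operator

theorem norm_matrix_le {ι : Type} [Fintype ι] [DecidableEq ι] (M : Matrix ι ι ℂ) {c : ℝ}
    (hc : 0 ≤ c) (h : ∀ v : ι → ℂ, ∑ i, ‖M.mulVec v i‖ ^ 2 ≤ c ^ 2 * ∑ i, ‖v i‖ ^ 2) :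
    ‖M‖ ≤ c := by
  rw [Matrix.cstar_norm_def]
  refine ContinuousLinearMap.opNorm_le_bound _ hc fun v => ?_
  rw [EuclideanSpace.norm_eq, EuclideanSpace.norm_eq, ← Real.sqrt_sq hc,
    ← Real.sqrt_mul (sq_nonneg c)]
  refine Real.sqrt_le_sqrt ?_
  simpa using h v.ofLp

theorem sum_norm_sq_mulVec_le {ι : Type} [Fintype ι] [DecidableEq ι] (M : Matrix ι ι ℂ)
    (v : ι → ℂ) : ∑ i, ‖M.mulVec v i‖ ^ 2 ≤ ‖M‖ ^ 2 * ∑ i, ‖v i‖ ^ 2 := by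
  have h := Matrix.l2_opNorm_mulVec M (WithLp.toLp 2 v)
  have h2 := pow_le_pow_left₀ (norm_nonneg _) h 2
  rw [mul_pow, EuclideanSpace.norm_sq_eq, EuclideanSpace.norm_sq_eq] at h2
  simpa using h2

/-- A matrix with at most one nonzero entry in each row and column. -/
theorem norm_matrix_le_of_subsingleton {ι : Type} [Fintype ι] [DecidableEq ι] (M : Matrix ι ι ℂ)
    {c : ℝ} (hc : 0 ≤ c) (h : ∀ i j, ‖M i j‖ ≤ c)
    (hr : ∀ i j j', M i j ≠ 0 → M i j' ≠ 0 → j = j')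
    (hl : ∀ i i' j, M i j ≠ 0 → M i' j ≠ 0 → i = i') : ‖M‖ ≤ c := by
  refine norm_matrix_le M hc fun v => ?_
  have h1 : ∀ i, ‖M.mulVec v i‖ ^ 2 = ∑ j, ‖M i j‖ ^ 2 * ‖v j‖ ^ 2 := by
    intro i
    rw [Matrix.mulVec, dotProduct]
    by_cases hi : ∃ j, M i j ≠ 0
    · obtain ⟨j, hj⟩ := hi
      have hz : ∀ j', j' ≠ j → M i j' = 0 := fun j' hne => by
        by_contra h'
        exact hne (hr i j' j h' hj)
      rw [Finset.sum_eq_single j (fun j' _ hne => by rw [hz j' hne, zero_mul]) (by simp),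
        Finset.sum_eq_single j (fun j' _ hne => by rw [hz j' hne]; simp) (by simp),
        norm_mul, mul_pow]
    · push Not at hi
      simp [hi]
  simp_rw [h1]
  rw [Finset.sum_comm, Finset.mul_sum]
  refine Finset.sum_le_sum fun j _ => ?_
  rw [← Finset.sum_mul]
  refine mul_le_mul_of_nonneg_right ?_ (by positivity)
  by_cases hj : ∃ i, M i j ≠ 0
  · obtain ⟨i, hi⟩ := hj
    rw [Finset.sum_eq_single i (fun i' _ hne => ?_) (by simp)]
    · have := h i j
      gcongr
    · have : M i' j = 0 := by
        by_contra h'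
        exact hne (hl i' i j h' hi)
      simp [this]
  · push Not at hj
    simp [hj, sq_nonneg]

end MatrixNorm

/-! ### Local kernels -/

section Locality

variable {S : Type} [DecidableEq S] [Fintype S]

theorem cutoff_eq_ite (Y : Finset S) (ν : ℝ) (n : S → ℕ) :
    cutoff Y ν n = open scoped Classical in if ∀ x ∈ Y, (n x : ℝ) ≤ ν then 1 else 0 := by
  classical
  rw [cutoff, Finset.prod_ite_zero]
  simp

theorem cutoff_ne_zero {Y : Finset S} {ν : ℝ} {n : S → ℕ} :
    cutoff Y ν n ≠ 0 ↔ ∀ x ∈ Y, (n x : ℝ) ≤ ν := by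
  rw [cutoff_eq_ite]
  split_ifs with h
  · simpa using h
  · simpa using h

theorem cutoff_of_le {Y : Finset S} {ν : ℝ} {n : S → ℕ} (h : ∀ x ∈ Y, (n x : ℝ) ≤ ν) :
    cutoff Y ν n = 1 := by
  rw [cutoff_eq_ite, if_pos h]

/-- The matrix `k m n = ⟨m, K n⟩` is that of a particle-number preserving operator `K` supported
on `X`. -/
structure IsLocalKernel (X : Finset S) (k : (S → ℕ) → (S → ℕ) → ℂ) : Prop where
  sum_eq : ∀ m n, k m n ≠ 0 → ∑ x, m x = ∑ x, n x
  eq_off : ∀ m n, k m n ≠ 0 → ∀ x ∉ X, m x = n x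
  congr : ∀ m n m' n', (∀ x ∈ X, m x = m' x) → (∀ x ∈ X, n x = n' x) →
    (∀ x ∉ X, m x = n x) → (∀ x ∉ X, m' x = n' x) → k m n = k m' n'

/-- The matrix of the truncation `Π K Π` in the `N`-particle sector. -/
def truncMat (Y : Finset S) (ν : ℝ) (N : ℕ) (k : (S → ℕ) → (S → ℕ) → ℂ) :
    Matrix (sector S N) (sector S N) ℂ :=
  fun m n => (cutoff Y ν m : ℂ) * ((cutoff Y ν n : ℂ) * k m n)

/-- Only one intermediate configuration can contribute: the operator on `Z` does not change the
sites of `X`, and the operator on `X` changes nothing else. Each site of that configuration is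
copied from `m` or `n`, so it passes the cutoff whenever both do. This is where the product form of
`Π` matters. -/
theorem truncMat_mul_apply_of_disjoint {X Z : Finset S} (hXZ : Disjoint X Z)
    {a b : (S → ℕ) → (S → ℕ) → ℂ} (ha : IsLocalKernel X a) (hb : IsLocalKernel Z b)
    (Y : Finset S) (ν : ℝ) (N : ℕ) (m n : sector S N) :
    (truncMat Y ν N a * truncMat Y ν N b) m n =
      (cutoff Y ν m : ℂ) * (cutoff Y ν n : ℂ) *
        (a m (fun x => if x ∈ X then n.1 x else m.1 x) *
          b (fun x => if x ∈ X then n.1 x else m.1 x) n) := by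
  obtain ⟨m, hm⟩ := m
  obtain ⟨n, hn⟩ := n
  set k₀ : S → ℕ := fun x => if x ∈ X then n x else m x with hk₀
  have huniq : ∀ k, a m k * b k n ≠ 0 → k = k₀ := by
    intro k hk
    funext x
    by_cases hx : x ∈ X
    · simp only [hk₀, if_pos hx]
      exact hb.eq_off _ _ (right_ne_zero_of_mul hk) x (Finset.disjoint_left.1 hXZ hx)
    · simp only [hk₀, if_neg hx]
      exact (ha.eq_off _ _ (left_ne_zero_of_mul hk) x hx).symm
  rw [Matrix.mul_apply]
  simp only [truncMat]
  -- The zero case is separate because `k₀` is known to lie in the sector only when the matrix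
  -- elements do not vanish.
  by_cases h0 : (cutoff Y ν m : ℂ) * (cutoff Y ν n : ℂ) * (a m k₀ * b k₀ n) = 0
  · rw [h0]
    refine Finset.sum_eq_zero fun k _ => ?_
    by_contra hne
    have hk : a m k * b k n ≠ 0 := by
      intro h
      refine hne ?_
      linear_combination (cutoff Y ν m : ℂ) * (cutoff Y ν k.1 : ℂ) * (cutoff Y ν k.1 : ℂ) *
        (cutoff Y ν n : ℂ) * h
    have hkk := huniq k hk
    rw [← hkk] at h0
    refine hne ?_
    linear_combination (cutoff Y ν k.1 : ℂ) * (cutoff Y ν k.1 : ℂ) * h0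
  · have hab := right_ne_zero_of_mul h0
    have hk₀N : k₀ ∈ sector S N := by
      rw [mem_sector, ← ha.sum_eq _ _ (left_ne_zero_of_mul hab)]
      exact mem_sector.1 hm
    have hcm : cutoff Y ν m ≠ 0 := by
      have := left_ne_zero_of_mul (left_ne_zero_of_mul h0)
      exact_mod_cast this
    have hcn : cutoff Y ν n ≠ 0 := by
      have := right_ne_zero_of_mul (left_ne_zero_of_mul h0)
      exact_mod_cast this
    have hck : cutoff Y ν k₀ = 1 := by
      refine cutoff_of_le fun x hx => ?_
      simp only [hk₀]
      split_ifs
      · exact cutoff_ne_zero.1 hcn x hx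
      · exact cutoff_ne_zero.1 hcm x hx
    rw [Finset.sum_eq_single (⟨k₀, hk₀N⟩ : sector S N)]
    · simp only [hck, Complex.ofReal_one]
      ring
    · intro k _ hk
      have : a m k * b k n = 0 := by
        by_contra h
        exact hk (Subtype.ext (huniq k h))
      linear_combination (cutoff Y ν m : ℂ) * (cutoff Y ν k.1 : ℂ) * (cutoff Y ν k.1 : ℂ) *
        (cutoff Y ν n : ℂ) * this
    · intro h
      exact absurd (Finset.mem_univ _) h

/-- Truncations of operators with disjoint supports commute. -/
theorem commute_truncMat {X Z : Finset S} (hXZ : Disjoint X Z)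
    {a b : (S → ℕ) → (S → ℕ) → ℂ} (ha : IsLocalKernel X a) (hb : IsLocalKernel Z b)
    (Y : Finset S) (ν : ℝ) (N : ℕ) : Commute (truncMat Y ν N a) (truncMat Y ν N b) := by
  ext m n
  rw [truncMat_mul_apply_of_disjoint hXZ ha hb, truncMat_mul_apply_of_disjoint hXZ.symm hb ha]
  congr 1
  -- A nonzero product forces `m` and `n` to agree off `X ∪ Z`. Locality then moves each matrix
  -- element to the intermediate configuration of the other order. The generality in `X`, `Z`, `a`,
  -- `b` allows the use from either side below.
  have key : ∀ {X Z : Finset S} (_ : Disjoint X Z) {a b : (S → ℕ) → (S → ℕ) → ℂ}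
      (_ : IsLocalKernel X a) (_ : IsLocalKernel Z b) (m n : S → ℕ),
      a m (fun x => if x ∈ X then n x else m x) * b (fun x => if x ∈ X then n x else m x) n ≠ 0 →
      a m (fun x => if x ∈ X then n x else m x) * b (fun x => if x ∈ X then n x else m x) n =
      b m (fun x => if x ∈ Z then n x else m x) * a (fun x => if x ∈ Z then n x else m x) n := by
    intro X Z hXZ a b ha hb m n h
    have hoff : ∀ x, x ∉ X → x ∉ Z → m x = n x := by
      intro x hX hZ
      have := hb.eq_off _ _ (right_ne_zero_of_mul h) x hZ
      simpa [hX] using this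
    rw [mul_comm]
    congr 1
    · refine hb.congr _ _ _ _ ?_ ?_ ?_ ?_
      · intro x hx
        simp [Finset.disjoint_right.1 hXZ hx]
      · intro x hx
        simp [hx]
      · intro x hx
        by_cases hX : x ∈ X
        · simp [hX]
        · simp [hX, hoff x hX hx]
      · intro x hx
        simp [hx]
    · refine ha.congr _ _ _ _ ?_ ?_ ?_ ?_
      · intro x hx
        simp [Finset.disjoint_left.1 hXZ hx]
      · intro x hx
        simp [hx]
      · intro x hx
        simp [hx]
      · intro x hx
        by_cases hZ : x ∈ Z
        · simp [hZ]
        · simp [hZ, hoff x hx hZ]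
  by_cases h : a m (fun x => if x ∈ X then n.1 x else m.1 x) *
      b (fun x => if x ∈ X then n.1 x else m.1 x) n = 0
  · rw [h]
    by_contra h2
    exact h2 (h.symm.trans (key hXZ.symm hb ha m n (Ne.symm h2)).symm)
  · exact key hXZ ha hb m n h

theorem isLocalKernel_diag {X : Finset S} {g : (S → ℕ) → ℝ}
    (hg : ∀ m n : S → ℕ, (∀ x ∈ X, m x = n x) → g m = g n) : IsLocalKernel X (elt (diag g)) where
  sum_eq m n h := by
    rw [elt_diag] at h
    have : m = n := by by_contra h'; simp [h'] at h
    rw [this]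
  eq_off m n h x _ := by
    rw [elt_diag] at h
    have : m = n := by by_contra h'; simp [h'] at h
    rw [this]
  congr m n m' n' hm hn h h' := by
    rw [elt_diag, elt_diag, hg m m' hm]
    refine if_congr ⟨fun e => ?_, fun e => ?_⟩ rfl rfl
    · funext x
      by_cases hx : x ∈ X
      · rw [← hm x hx, ← hn x hx, e]
      · exact h' x hx
    · funext x
      by_cases hx : x ∈ X
      · rw [hm x hx, hn x hx, e]
      · exact h x hx

theorem isLocalKernel_pot (U μ p : ℝ) (x y : S) : IsLocalKernel {x, y} (elt (pot U μ p x y)) := by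
  rw [pot_eq_diag]
  refine isLocalKernel_diag fun m n h => ?_
  rw [h x (by simp), h y (by simp)]

/-- The additive form of the selection rule avoids truncated subtraction and makes it plain that `m`
and `n` determine each other. -/
theorem elt_hop (J : ℝ) {x y : S} (hxy : x ≠ y) (m n : S → ℕ) :
    elt (hop J x y) m n = if m + Pi.single y 1 = n + Pi.single x 1 then
      ((J * (Real.sqrt (m x) * Real.sqrt (n y)) : ℝ) : ℂ) else 0 := by
  rw [hop, elt_smul]
  by_cases hm : m x = 0
  · have h1 : elt (creat x * annih y) m n = 0 := creat_annih_apply_zero x y _ m hm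
    rw [h1, mul_zero, if_neg]
    intro h
    have := congrFun h x
    simp [hm, hxy] at this
  · obtain ⟨k, rfl⟩ := exists_eq_add_single x m hm
    rw [elt_creat_annih]
    have h1 : n = k + Pi.single y 1 ↔
        k + Pi.single x 1 + Pi.single y 1 = n + Pi.single x 1 := by
      rw [add_right_comm, add_left_inj, eq_comm]
    by_cases h : n = k + Pi.single y 1
    · rw [if_pos h, if_pos (h1.1 h)]
      subst h
      simp
    · rw [if_neg h, if_neg fun h' => h (h1.2 h'), mul_zero]

theorem isLocalKernel_hop (J : ℝ) {x y : S} (hxy : x ≠ y) :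
    IsLocalKernel {x, y} (elt (hop J x y)) where
  sum_eq m n h := by
    rw [elt_hop J hxy] at h
    have h1 : m + Pi.single y 1 = n + Pi.single x 1 := by by_contra h'; simp [h'] at h
    have h2 := congrArg (fun f : S → ℕ => ∑ z, f z) h1
    simpa [Finset.sum_add_distrib] using h2
  eq_off m n h z hz := by
    rw [elt_hop J hxy] at h
    have h1 : m + Pi.single y 1 = n + Pi.single x 1 := by by_contra h'; simp [h'] at h
    simp only [Finset.mem_insert, Finset.mem_singleton, not_or] at hz
    simpa [hz.1, hz.2] using congrFun h1 z
  congr m n m' n' hm hn h h' := by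
    rw [elt_hop J hxy, elt_hop J hxy, hm x (by simp), hn y (by simp)]
    refine if_congr ⟨fun e => ?_, fun e => ?_⟩ rfl rfl
    · funext z
      by_cases hz : z ∈ ({x, y} : Finset S)
      · simpa [← hm z hz, ← hn z hz] using congrFun e z
      · have h1 := h' z hz
        simp only [Finset.mem_insert, Finset.mem_singleton, not_or] at hz
        simp [hz.1, hz.2, h1]
    · funext z
      by_cases hz : z ∈ ({x, y} : Finset S)
      · simpa [hm z hz, hn z hz] using congrFun e z
      · have h1 := h z hz
        simp only [Finset.mem_insert, Finset.mem_singleton, not_or] at hz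
        simp [hz.1, hz.2, h1]

theorem elt_barFormal (Y : Finset S) (ν : ℝ) (K : FormalOp S) (m n : S → ℕ) :
    elt (barFormal Y ν K) m n = (cutoff Y ν m : ℂ) * ((cutoff Y ν n : ℂ) * elt K m n) := by
  have hs : truncFormal Y ν (Pi.single n (1 : ℂ)) = (cutoff Y ν n : ℂ) • Pi.single n (1 : ℂ) := by
    funext k
    by_cases h : k = n
    · subst h; simp [truncFormal, diag_apply]
    · simp [truncFormal, diag_apply, h]
  rw [elt, barFormal, Module.End.mul_apply, Module.End.mul_apply, hs, map_smul]
  rfl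

theorem block_barFormal (Y : Finset S) (ν : ℝ) (K : FormalOp S) (N : ℕ) :
    block (barFormal Y ν K) N = truncMat Y ν N (elt K) := by
  ext m n
  exact elt_barFormal Y ν K m n

open scoped Matrix.Norms.L2Operator

/-- A truncated hopping term is bounded by `|J| ν`. -/
theorem norm_truncMat_hop_le (J : ℝ) {x y : S} (hxy : x ≠ y) {Y : Finset S} (hx : x ∈ Y)
    (hy : y ∈ Y) {ν : ℝ} (hν : 0 ≤ ν) (N : ℕ) : ‖truncMat Y ν N (elt (hop J x y))‖ ≤ |J| * ν := by
  have hne : ∀ m n : sector S N, truncMat Y ν N (elt (hop J x y)) m n ≠ 0 →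
      m.1 + Pi.single y 1 = n.1 + Pi.single x 1 := by
    intro m n h
    have h1 := right_ne_zero_of_mul (right_ne_zero_of_mul h)
    rw [elt_hop J hxy] at h1
    by_contra h'
    simp [h'] at h1
  -- Hopping is a weighted partial injection of the basis, so its norm is controlled by its entries
  -- `J √(m x) √(n y)`; both endpoints lie in `Y`, so each root is at most `√ν`.
  refine norm_matrix_le_of_subsingleton _ (by positivity) (fun m n => ?_) (fun m n n' h h' => ?_)
    fun m m' n h h' => ?_
  · by_cases h : truncMat Y ν N (elt (hop J x y)) m n = 0
    · rw [h, norm_zero]; positivity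
    · have hm : cutoff Y ν m ≠ 0 := by
        have := left_ne_zero_of_mul h
        exact_mod_cast this
      have hn : cutoff Y ν n ≠ 0 := by
        have := left_ne_zero_of_mul (right_ne_zero_of_mul h)
        exact_mod_cast this
      have hm' := cutoff_ne_zero.1 hm
      have hn' := cutoff_ne_zero.1 hn
      rw [truncMat, elt_hop J hxy, if_pos (hne m n h), cutoff_of_le hm', cutoff_of_le hn',
        Complex.ofReal_one, one_mul, one_mul, Complex.norm_real, Real.norm_eq_abs, abs_mul,
        abs_of_nonneg (by positivity : 0 ≤ √(m.1 x : ℝ) * √(n.1 y : ℝ)), ← Real.mul_self_sqrt hν]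
      have h1 : √(m.1 x : ℝ) ≤ √ν := Real.sqrt_le_sqrt (hm' x hx)
      have h2 : √(n.1 y : ℝ) ≤ √ν := Real.sqrt_le_sqrt (hn' y hy)
      gcongr
  · have := (hne m n h).symm.trans (hne m n' h')
    exact Subtype.ext (add_right_cancel this)
  · have := (hne m n h).trans (hne m' n h').symm
    exact Subtype.ext (add_right_cancel this)

/-- The kernel of an operator on Fock space. -/
def fockKernel (A : Fock S →L[ℂ] Fock S) (m n : S → ℕ) : ℂ := A (basisVec n) m

theorem coe_basisVec (n : S → ℕ) : ⇑(basisVec n : Fock S) = Pi.single n (1 : ℂ) := by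
  rw [basisVec, lp.coeFn_single]

theorem totalNumber_apply (f : (S → ℕ) → ℂ) (n : S → ℕ) :
    totalNumber S f n = ((∑ x, n x : ℕ) : ℂ) * f n := by
  simp [totalNumber, number_eq_diag, LinearMap.sum_apply, Finset.sum_apply, diag_apply,
    Finset.sum_mul]

/-- Basis vectors are eigenvectors of the total number operator, so a nonzero matrix element forces
equal eigenvalues. -/
theorem sum_eq_of_fockKernel_ne_zero {A : Fock S →L[ℂ] Fock S}
    (hA : CommutesWith A (totalNumber S)) (m n : S → ℕ) (h : fockKernel A m n ≠ 0) :
    ∑ x, m x = ∑ x, n x := by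
  have h1 : totalNumber S ⇑(basisVec n : Fock S) =
      ⇑(((∑ x, n x : ℕ) : ℂ) • basisVec n : Fock S) := by
    funext k
    rw [totalNumber_apply, lp.coeFn_smul, Pi.smul_apply, smul_eq_mul, coe_basisVec]
    by_cases hk : k = n
    · rw [hk]
    · simp [hk]
  have h2 := congrFun (hA _ _ h1) m
  rw [totalNumber_apply, map_smul, lp.coeFn_smul, Pi.smul_apply, smul_eq_mul] at h2
  exact_mod_cast mul_right_cancel₀ h h2

theorem IsInvariantLocal.isLocalKernel {X : Finset S} {A : Fock S →L[ℂ] Fock S}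
    (hA : IsInvariantLocal X A) : IsLocalKernel X (fockKernel A) where
  sum_eq := sum_eq_of_fockKernel_ne_zero hA.2
  eq_off m n h := by
    obtain ⟨B, hB⟩ := hA.1
    rw [fockKernel, hB] at h
    by_contra h'
    rw [if_neg h'] at h
    exact h rfl
  congr m n m' n' hm hn h h' := by
    obtain ⟨B, hB⟩ := hA.1
    rw [fockKernel, fockKernel, hB, hB, if_pos h, if_pos h']
    have h1 : (fun x : X => m x) = fun x : X => m' x := funext fun x => hm x x.2
    have h2 : (fun x : X => n x) = fun x : X => n' x := funext fun x => hn x x.2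
    rw [h1, h2]

end Locality

/-! ### Operators on Fock space that preserve the particle number -/

section Blocks

open scoped Matrix.Norms.L2Operator

variable {S : Type} [DecidableEq S] [Fintype S]

/-- The bounded operator `A` is the direct sum of the matrices `a N`. -/
def HasBlocks (A : Fock S →L[ℂ] Fock S) (a : ∀ N, Matrix (sector S N) (sector S N) ℂ) : Prop :=
  ∀ (f : Fock S) (N : ℕ) (m : sector S N), A f m = (a N).mulVec (fun n => f n) m

namespace HasBlocks

variable {A B : Fock S →L[ℂ] Fock S} {a b : ∀ N, Matrix (sector S N) (sector S N) ℂ}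

theorem mul (hA : HasBlocks A a) (hB : HasBlocks B b) : HasBlocks (A * B) fun N => a N * b N := by
  intro f N m
  have h : (fun n : sector S N => B f n) = (b N).mulVec fun n => f n := funext fun n => hB f N n
  rw [← Matrix.mulVec_mulVec, ← h]
  exact hA (B f) N m

theorem sub (hA : HasBlocks A a) (hB : HasBlocks B b) : HasBlocks (A - B) fun N => a N - b N := by
  intro f N m
  rw [Matrix.sub_mulVec, Pi.sub_apply, ← hA f N m, ← hB f N m]
  rfl

/-- A sector embeds isometrically in Fock space, by extending vectors by zero. -/
theorem norm_block_le (hA : HasBlocks A a) (N : ℕ) : ‖a N‖ ≤ ‖A‖ := by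
  refine norm_matrix_le _ (norm_nonneg _) fun v => ?_
  set v' : (S → ℕ) → ℂ := fun n => if h : n ∈ sector S N then v ⟨n, h⟩ else 0 with hv'
  have hv : ∀ n : sector S N, v' n = v n := fun n => by simp [hv']
  set f : Fock S := ∑ n ∈ sector S N, lp.single 2 n (v' n) with hf
  have hfn : ‖f‖ ^ 2 = ∑ n, ‖v n‖ ^ 2 := by
    have h := lp.norm_sum_single (p := 2) (by simp) v' (sector S N)
    simp only [ENNReal.toReal_ofNat, Real.rpow_ofNat] at h
    rw [hf, h, ← Finset.sum_coe_sort]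
    simp_rw [hv]
  have hfv : (fun n : sector S N => f n) = v := by
    funext n
    rw [hf, lp.coeFn_sum, Finset.sum_apply, Finset.sum_eq_single_of_mem n.1 n.2, lp.coeFn_single,
      Pi.single_eq_same, hv]
    intro k _ hk
    rw [lp.coeFn_single, Pi.single_eq_of_ne (Ne.symm hk)]
  calc ∑ i, ‖(a N).mulVec v i‖ ^ 2 = ∑ m ∈ sector S N, ‖A f m‖ ^ 2 := by
        rw [← Finset.sum_coe_sort (sector S N)]
        refine Finset.sum_congr rfl fun m _ => ?_
        rw [hA f N m, hfv]
    _ ≤ ‖A f‖ ^ 2 := sum_sq_le _ _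
    _ ≤ (‖A‖ * ‖f‖) ^ 2 := by gcongr; exact A.le_opNorm f
    _ = ‖A‖ ^ 2 * ∑ n, ‖v n‖ ^ 2 := by rw [mul_pow, hfn]

/-- The sectors are mutually orthogonal, so a bound uniform in `N` passes to the direct sum. -/
theorem norm_le (hA : HasBlocks A a) {c : ℝ} (hc : 0 ≤ c) (h : ∀ N, ‖a N‖ ≤ c) : ‖A‖ ≤ c := by
  refine ContinuousLinearMap.opNorm_le_bound _ hc fun f => ?_
  refine lp.norm_le_of_forall_sum_le (by simp) (by positivity) fun s => ?_
  simp only [ENNReal.toReal_ofNat, Real.rpow_ofNat]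
  set T : Finset ℕ := s.image fun m => ∑ x, m x
  have hdis : (T : Set ℕ).PairwiseDisjoint (sector S) := by
    intro N _ M _ hNM
    refine Finset.disjoint_left.2 fun m h1 h2 => hNM ?_
    rw [← mem_sector.1 h1, ← mem_sector.1 h2]
  have hs : s ⊆ T.biUnion (sector S) := fun m hm =>
    Finset.mem_biUnion.2 ⟨_, Finset.mem_image_of_mem _ hm, mem_sector.2 rfl⟩
  calc ∑ m ∈ s, ‖A f m‖ ^ 2
      ≤ ∑ m ∈ T.biUnion (sector S), ‖A f m‖ ^ 2 :=
        Finset.sum_le_sum_of_subset_of_nonneg hs fun _ _ _ => by positivity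
    _ = ∑ N ∈ T, ∑ m ∈ sector S N, ‖A f m‖ ^ 2 := Finset.sum_biUnion hdis
    _ ≤ ∑ N ∈ T, c ^ 2 * ∑ m ∈ sector S N, ‖f m‖ ^ 2 := by
        refine Finset.sum_le_sum fun N _ => ?_
        rw [← Finset.sum_coe_sort (sector S N), ← Finset.sum_coe_sort (sector S N)]
        simp_rw [hA f N]
        refine (sum_norm_sq_mulVec_le _ _).trans ?_
        have := h N
        gcongr
    _ = c ^ 2 * ∑ m ∈ T.biUnion (sector S), ‖f m‖ ^ 2 := by
        rw [Finset.sum_biUnion hdis, Finset.mul_sum]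
    _ ≤ c ^ 2 * ‖f‖ ^ 2 := by gcongr; exact sum_sq_le f _
    _ = (c * ‖f‖) ^ 2 := by ring

end HasBlocks

theorem hasBlocks_evolution (K : FormalOp S) (hK : IsSectorHermitian K) (t : ℝ) :
    HasBlocks (evolution K hK t) fun N => propagator (block K N) t :=
  fun f _ m => evolFormal_apply K t f m

theorem HasBlocks.heisenberg {A : Fock S →L[ℂ] Fock S}
    {a : ∀ N, Matrix (sector S N) (sector S N) ℂ} (hA : HasBlocks A a) (K : FormalOp S)
    (hK : IsSectorHermitian K) (t : ℝ) :
    HasBlocks (heisenberg K hK t A) fun N => conjDyn (block K N) t (a N) :=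
  ((hasBlocks_evolution K hK t).mul hA).mul (hasBlocks_evolution K hK (-t))

/-- Continuity of `A` allows the basis expansion of `f`, and number conservation leaves only the
finitely many terms in the sector of `m`. -/
theorem apply_eq_sum_fockKernel {A : Fock S →L[ℂ] Fock S} (hA : CommutesWith A (totalNumber S))
    (f : Fock S) {N : ℕ} (m : sector S N) : A f m = ∑ n : sector S N, fockKernel A m n * f n := by
  have h1 : HasSum (fun n => A (lp.single 2 n (f n)) m) (A f m) :=
    (lp.hasSum_single (by simp) f).map
      ((lp.evalCLM ℂ (fun _ : S → ℕ => ℂ) 2 m.1).comp A) (ContinuousLinearMap.continuous _)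
  have h2 : ∀ n, A (lp.single 2 n (f n)) m = fockKernel A m n * f n := by
    intro n
    have : (lp.single 2 n (f n) : Fock S) = f n • basisVec n := by
      rw [basisVec, ← lp.single_smul, smul_eq_mul, mul_one]
    rw [this, map_smul, lp.coeFn_smul, Pi.smul_apply, smul_eq_mul, mul_comm, fockKernel]
  simp_rw [h2] at h1
  have h3 : HasSum (fun n => fockKernel A m n * f n) (∑ n ∈ sector S N, fockKernel A m n * f n) := by
    refine hasSum_sum_of_ne_finset_zero fun n hn => ?_
    have : fockKernel A m n = 0 := by
      by_contra h
      exact hn (mem_sector.2 ((sum_eq_of_fockKernel_ne_zero hA _ _ h).symm.trans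
        (mem_sector.1 m.2)))
    rw [this, zero_mul]
  rw [h1.unique h3, ← Finset.sum_coe_sort]

theorem trunc_apply (Y : Finset S) (ν : ℝ) (f : Fock S) (m : S → ℕ) :
    trunc Y ν f m = (cutoff Y ν m : ℂ) * f m := rfl

theorem norm_contraction_le (F : FormalOp S)
    (h : ∀ (f : Fock S) (s : Finset (S → ℕ)), ∑ m ∈ s, ‖F ⇑f m‖ ^ 2 ≤ ‖f‖ ^ 2) :
    ‖contraction F h‖ ≤ 1 := by
  refine ContinuousLinearMap.opNorm_le_bound _ zero_le_one fun f => ?_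
  rw [one_mul]
  refine lp.norm_le_of_forall_sum_le (by simp) (norm_nonneg _) fun s => ?_
  simpa [contraction_apply] using h f s

theorem norm_trunc_le (Y : Finset S) (ν : ℝ) : ‖(trunc Y ν : Fock S →L[ℂ] Fock S)‖ ≤ 1 :=
  norm_contraction_le _ _

theorem norm_barOp_le (Y : Finset S) (ν : ℝ) (A : Fock S →L[ℂ] Fock S) :
    ‖barOp Y ν A‖ ≤ ‖A‖ := by
  have h := norm_trunc_le Y ν
  calc ‖barOp Y ν A‖ ≤ ‖(trunc Y ν : Fock S →L[ℂ] Fock S)‖ * ‖A‖ *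
        ‖(trunc Y ν : Fock S →L[ℂ] Fock S)‖ :=
        (norm_mul_le _ _).trans (mul_le_mul_of_nonneg_right (norm_mul_le _ _) (norm_nonneg _))
    _ ≤ 1 * ‖A‖ * 1 := by gcongr
    _ = ‖A‖ := by ring

theorem hasBlocks_barOp {A : Fock S →L[ℂ] Fock S} (hA : CommutesWith A (totalNumber S))
    (Y : Finset S) (ν : ℝ) : HasBlocks (barOp Y ν A) fun N => truncMat Y ν N (fockKernel A) := by
  intro f N m
  change trunc Y ν (A (trunc Y ν f)) m = _
  rw [trunc_apply, apply_eq_sum_fockKernel hA, Finset.mul_sum, Matrix.mulVec, dotProduct]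
  refine Finset.sum_congr rfl fun n _ => ?_
  rw [trunc_apply]
  simp only [truncMat]
  ring

end Blocks

/-! ### Geometry of the lattice -/

section Lattice

variable {d : ℕ}

/-- The embedding of `ℤ^d` into Euclidean space. -/
def toEuclidean (x : Fin d → ℤ) : EuclideanSpace ℝ (Fin d) := WithLp.toLp 2 fun i => (x i : ℝ)

theorem latticeDist_eq_dist (x y : Fin d → ℤ) :
    latticeDist x y = dist (toEuclidean x) (toEuclidean y) := by
  rw [EuclideanSpace.dist_eq, latticeDist]
  simp [toEuclidean, Real.dist_eq, sq_abs]

theorem latticeDist_self (x : Fin d → ℤ) : latticeDist x x = 0 := by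
  rw [latticeDist_eq_dist, dist_self]

theorem latticeDist_comm (x y : Fin d → ℤ) : latticeDist x y = latticeDist y x := by
  rw [latticeDist_eq_dist, latticeDist_eq_dist, dist_comm]

theorem latticeDist_triangle (x y z : Fin d → ℤ) :
    latticeDist x z ≤ latticeDist x y + latticeDist y z := by
  simp only [latticeDist_eq_dist]
  exact dist_triangle _ _ _

theorem abs_sub_le_latticeDist (x y : Fin d → ℤ) (i : Fin d) :
    |(x i : ℝ) - y i| ≤ latticeDist x y := by
  rw [latticeDist]
  refine Real.abs_le_sqrt ?_
  exact Finset.single_le_sum (f := fun i => ((x i : ℝ) - y i) ^ 2) (fun _ _ => sq_nonneg _)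
    (Finset.mem_univ i)

variable {Λ : Finset (Fin d → ℤ)}

/-- Euclidean distance from `X`. -/
def distTo (X : Finset Λ) (x : Λ) : ℝ :=
  Metric.infDist (toEuclidean x.1) ((fun y : Λ => toEuclidean y.1) '' X)

theorem distTo_le_add (X : Finset Λ) (x y : Λ) :
    distTo X x ≤ distTo X y + latticeDist x.1 y.1 := by
  rw [latticeDist_eq_dist]
  exact Metric.infDist_le_infDist_add_dist

theorem distTo_le {X : Finset Λ} (x : Λ) {y : Λ} (hy : y ∈ X) :
    distTo X x ≤ latticeDist x.1 y.1 := by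
  rw [latticeDist_eq_dist]
  exact Metric.infDist_le_dist_of_mem ⟨y, hy, rfl⟩

theorem mem_enlarge {X : Finset Λ} {r : ℝ} {x : Λ} :
    x ∈ enlarge X r ↔ ∃ y ∈ X, latticeDist x.1 y.1 ≤ r := by
  classical
  simp [enlarge]

/-- Nonemptiness matters: `Metric.infDist` to the empty set is `0`, whereas the enlargement of the
empty set is empty. -/
theorem le_distTo {X : Finset Λ} (hX : X.Nonempty) {r : ℝ} {x : Λ} (hx : x ∉ enlarge X r) :
    r ≤ distTo X x := by
  refine (Metric.le_infDist ((Finset.coe_nonempty.2 hX).image _)).2 ?_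
  rintro _ ⟨y, hy, rfl⟩
  rw [← latticeDist_eq_dist]
  by_contra h
  exact hx (mem_enlarge.2 ⟨y, hy, (not_le.1 h).le⟩)

theorem mem_enlarge_of_dist_le {X : Finset Λ} {r s : ℝ} {x y : Λ} (hx : x ∈ enlarge X r)
    {c : ℝ} (hxy : latticeDist x.1 y.1 ≤ c) (h : r + c ≤ s) : y ∈ enlarge X s := by
  obtain ⟨z, hz, hxz⟩ := mem_enlarge.1 hx
  refine mem_enlarge.2 ⟨z, hz, ?_⟩
  have := latticeDist_triangle y.1 x.1 z.1
  rw [latticeDist_comm y.1 x.1] at this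
  linarith

theorem subset_enlarge (X : Finset Λ) {r : ℝ} (hr : 0 ≤ r) : X ⊆ enlarge X r := fun x hx =>
  mem_enlarge.2 ⟨x, hx, by rwa [latticeDist_self]⟩

theorem enlarge_mono (X : Finset Λ) {r s : ℝ} (h : r ≤ s) : enlarge X r ⊆ enlarge X s := by
  intro x hx
  obtain ⟨y, hy, hxy⟩ := mem_enlarge.1 hx
  exact mem_enlarge.2 ⟨y, hy, hxy.trans h⟩

theorem card_ball_le (x : Λ) {r : ℝ} (hr : 0 ≤ r) :
    open scoped Classical in
    ((Finset.univ.filter fun y : Λ => latticeDist x.1 y.1 ≤ r).card : ℝ) ≤ (2 * r + 1) ^ d := by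
  classical
  set s := Finset.univ.filter fun y : Λ => latticeDist x.1 y.1 ≤ r with hs
  have h1 : s.card ≤
      (Fintype.piFinset fun i => Finset.Icc (x.1 i - ⌊r⌋) (x.1 i + ⌊r⌋)).card := by
    refine Finset.card_le_card_of_injOn (fun y => y.1) (fun y hy => ?_)
      fun y _ z _ h => Subtype.ext h
    have hy' : latticeDist x.1 y.1 ≤ r := (Finset.mem_filter.1 hy).2
    refine Fintype.mem_piFinset.2 fun i => ?_
    have h2 := (abs_sub_le_latticeDist x.1 y.1 i).trans hy'
    have h3 : |x.1 i - y.1 i| ≤ ⌊r⌋ := Int.le_floor.2 (by push_cast; exact h2)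
    rw [abs_le] at h3
    refine Finset.mem_Icc.2 ⟨?_, ?_⟩ <;> dsimp only <;> omega
  have h4 : ∀ i, (Finset.Icc (x.1 i - ⌊r⌋) (x.1 i + ⌊r⌋)).card = (2 * ⌊r⌋ + 1).toNat := by
    intro i
    rw [Int.card_Icc]
    congr 1
    ring
  rw [Fintype.card_piFinset, Finset.prod_congr rfl fun i _ => h4 i, Finset.prod_const,
    Finset.card_univ, Fintype.card_fin] at h1
  have h5 : (((2 * ⌊r⌋ + 1).toNat : ℕ) : ℝ) ≤ 2 * r + 1 := by
    have h6 : (((2 * ⌊r⌋ + 1).toNat : ℕ) : ℤ) = 2 * ⌊r⌋ + 1 :=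
      Int.toNat_of_nonneg (by have := Int.floor_nonneg.2 hr; omega)
    have h7 : (((2 * ⌊r⌋ + 1).toNat : ℕ) : ℝ) = 2 * (⌊r⌋ : ℝ) + 1 := by exact_mod_cast h6
    rw [h7]
    have := Int.floor_le r
    linarith
  calc (s.card : ℝ) ≤ (((2 * ⌊r⌋ + 1).toNat : ℕ) : ℝ) ^ d := by exact_mod_cast h1
    _ ≤ _ := pow_le_pow_left₀ (Nat.cast_nonneg _) h5 d

theorem card_enlarge_le (X : Finset Λ) {r : ℝ} (hr : 0 ≤ r) :
    ((enlarge X r).card : ℝ) ≤ X.card * (2 * r + 1) ^ d := by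
  classical
  have h1 : enlarge X r ⊆
      X.biUnion fun x => Finset.univ.filter fun y : Λ => latticeDist x.1 y.1 ≤ r := by
    intro y hy
    obtain ⟨x, hx, hxy⟩ := mem_enlarge.1 hy
    rw [latticeDist_comm] at hxy
    exact Finset.mem_biUnion.2 ⟨x, hx, by simpa using hxy⟩
  have h2 := (Finset.card_le_card h1).trans Finset.card_biUnion_le
  calc ((enlarge X r).card : ℝ)
      ≤ ∑ x ∈ X, ((Finset.univ.filter fun y : Λ => latticeDist x.1 y.1 ≤ r).card : ℝ) := by
        exact_mod_cast h2
    _ ≤ ∑ x ∈ X, (2 * r + 1) ^ d := Finset.sum_le_sum fun x _ => by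
        convert card_ball_le x hr
    _ = _ := by simp

/-- The ordered pairs of neighbouring sites in `Z`. -/
def edges (Z : Finset Λ) : Finset (Λ × Λ) :=
  open scoped Classical in (Z ×ˢ Z).filter fun e => latticeDist e.1.1 e.2.1 = 1

/-- The sites of a pair. -/
def ends (e : Λ × Λ) : Finset Λ := {e.1, e.2}

theorem mem_edges {Z : Finset Λ} {e : Λ × Λ} :
    e ∈ edges Z ↔ (e.1 ∈ Z ∧ e.2 ∈ Z) ∧ latticeDist e.1.1 e.2.1 = 1 := by
  simp [edges]

theorem mem_of_mem_edges {Z : Finset Λ} {e : Λ × Λ} (he : e ∈ edges Z) {a : Λ}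
    (ha : a ∈ ends e) : a ∈ Z := by
  simp only [ends, Finset.mem_insert, Finset.mem_singleton] at ha
  obtain rfl | rfl := ha
  · exact (mem_edges.1 he).1.1
  · exact (mem_edges.1 he).1.2

theorem fst_mem_ends (e : Λ × Λ) : e.1 ∈ ends e := by simp [ends]

theorem snd_mem_ends (e : Λ × Λ) : e.2 ∈ ends e := by simp [ends]

theorem latticeDist_ends_le {e : Λ × Λ} (he : e ∈ edges (Finset.univ : Finset Λ)) {a b : Λ}
    (ha : a ∈ ends e) (hb : b ∈ ends e) : latticeDist a.1 b.1 ≤ 1 := by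
  have h := (mem_edges.1 he).2
  simp only [ends, Finset.mem_insert, Finset.mem_singleton] at ha hb
  obtain rfl | rfl := ha <;> obtain rfl | rfl := hb
  · rw [latticeDist_self]; exact zero_le_one
  · exact h.le
  · rw [latticeDist_comm]; exact h.le
  · rw [latticeDist_self]; exact zero_le_one

theorem edges_mono {Z W : Finset Λ} (h : Z ⊆ W) : edges Z ⊆ edges W := by
  intro e he
  obtain ⟨h1, h2⟩ := mem_edges.1 he
  exact mem_edges.2 ⟨⟨h h1.1, h h1.2⟩, h2⟩

theorem mem_edges_univ {Z : Finset Λ} {e : Λ × Λ} (he : e ∈ edges Z) :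
    e ∈ edges (Finset.univ : Finset Λ) := edges_mono (Finset.subset_univ _) he

theorem ne_of_mem_edges {Z : Finset Λ} {e : Λ × Λ} (he : e ∈ edges Z) : e.1 ≠ e.2 := by
  intro h
  have := (mem_edges.1 he).2
  rw [h, latticeDist_self] at this
  exact zero_ne_one this

/-- All neighbours of a site lie in a cube of side three around it. -/
theorem card_edges_le (B : Finset Λ) (P : Finset (Λ × Λ))
    (hP : P ⊆ edges (Finset.univ : Finset Λ)) (hB : ∀ e ∈ P, e.1 ∈ B) :
    (P.card : ℝ) ≤ B.card * 3 ^ d := by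
  classical
  have h1 : P ⊆ B.biUnion fun x =>
      (Finset.univ.filter fun y : Λ => latticeDist x.1 y.1 ≤ 1).image (Prod.mk x) := by
    intro e he
    refine Finset.mem_biUnion.2 ⟨e.1, hB e he, Finset.mem_image.2 ⟨e.2, ?_, rfl⟩⟩
    simpa using (mem_edges.1 (hP he)).2.le
  have h2 := (Finset.card_le_card h1).trans Finset.card_biUnion_le
  calc (P.card : ℝ)
      ≤ ∑ x ∈ B, (((Finset.univ.filter fun y : Λ => latticeDist x.1 y.1 ≤ 1).image
          (Prod.mk x)).card : ℝ) := by exact_mod_cast h2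
    _ ≤ ∑ x ∈ B, 3 ^ d := Finset.sum_le_sum fun x _ => by
        refine (Nat.cast_le.2 Finset.card_image_le).trans ?_
        have h3 := card_ball_le x (zero_le_one (α := ℝ))
        rw [show (2 * 1 + 1 : ℝ) = 3 by norm_num] at h3
        convert h3
    _ = _ := by simp

end Lattice

/-! ### The Bose–Hubbard Hamiltonian in a sector -/

section Sector

open scoped Matrix.Norms.L2Operator

variable {d : ℕ} {Λ : Finset (Fin d → ℤ)}

/-- The truncated hopping term of a pair in the `N`-particle sector. -/
def hopMat (J : ℝ) (Y : Finset Λ) (ν : ℝ) (N : ℕ) (e : Λ × Λ) :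
    Matrix (sector Λ N) (sector Λ N) ℂ := truncMat Y ν N (elt (hop J e.1 e.2))

/-- The truncated interaction of a pair in the `N`-particle sector. -/
def potMat (U μ p : ℝ) (Y : Finset Λ) (ν : ℝ) (N : ℕ) (e : Λ × Λ) :
    Matrix (sector Λ N) (sector Λ N) ℂ := truncMat Y ν N (elt (pot U μ p e.1 e.2))

theorem truncMat_add (Y : Finset Λ) (ν : ℝ) (N : ℕ) (K L : FormalOp Λ) :
    truncMat Y ν N (elt (K + L)) = truncMat Y ν N (elt K) + truncMat Y ν N (elt L) := by
  ext m n
  simp only [truncMat, elt_add, Matrix.add_apply]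
  ring

theorem truncMat_zero (Y : Finset Λ) (ν : ℝ) (N : ℕ) :
    truncMat Y ν N (elt (0 : FormalOp Λ)) = 0 := by
  ext m n
  simp [truncMat, elt]

theorem truncMat_sum {ι : Type} (s : Finset ι) (Y : Finset Λ) (ν : ℝ) (N : ℕ)
    (K : ι → FormalOp Λ) :
    truncMat Y ν N (elt (∑ i ∈ s, K i)) = ∑ i ∈ s, truncMat Y ν N (elt (K i)) := by
  ext m n
  simp only [truncMat, elt_sum, Matrix.sum_apply, Finset.mul_sum]

theorem block_hamiltonian (J U μ p : ℝ) (Y : Finset Λ) (ν : ℝ) (N : ℕ) (Z : Finset Λ) :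
    block (barFormal Y ν (hamiltonian Λ J U μ p Z)) N =
      ∑ e ∈ edges Z, hopMat J Y ν N e + ∑ e ∈ edges Z, potMat U μ p Y ν N e := by
  classical
  have h : ∀ K : Λ → Λ → FormalOp Λ,
      truncMat Y ν N (elt (∑ x ∈ Z, ∑ y ∈ Z, if latticeDist x.1 y.1 = 1 then K x y else 0)) =
        ∑ e ∈ edges Z, truncMat Y ν N (elt (K e.1 e.2)) := by
    intro K
    have he : edges Z = (Z ×ˢ Z).filter fun e => latticeDist e.1.1 e.2.1 = 1 := by
      ext e; simp [edges]
    rw [he, Finset.sum_filter, Finset.sum_product, truncMat_sum]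
    refine Finset.sum_congr rfl fun x _ => ?_
    rw [truncMat_sum]
    refine Finset.sum_congr rfl fun y _ => ?_
    split_ifs
    · rfl
    · exact truncMat_zero Y ν N
  rw [block_barFormal, hamiltonian, truncMat_add]
  congr 1
  · convert h (hop J) using 2
    rfl
  · convert h (pot U μ p) using 2
    rfl

theorem isSelfAdjoint_block {K : FormalOp Λ} (hK : IsSectorHermitian K) (N : ℕ) :
    IsSelfAdjoint (block K N) := block_conjTranspose hK N

/-- A single ordered pair need not give a Hermitian term; the sum over both orders does. This is
read off from the Hamiltonian without interaction. -/
theorem isSelfAdjoint_sum_hopMat (J : ℝ) (Y : Finset Λ) (ν : ℝ) (N : ℕ) (Z : Finset Λ) :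
    IsSelfAdjoint (∑ e ∈ edges Z, hopMat J Y ν N e) := by
  have h := isSelfAdjoint_block ((IsSectorHermitian.hamiltonian Λ J 0 0 0 Z).barFormal Y ν) N
  have h0 : ∀ e : Λ × Λ, potMat 0 0 0 Y ν N e = 0 := by
    intro e
    have : pot 0 0 0 e.1 e.2 = (0 : FormalOp Λ) := by simp [pot]
    rw [potMat, this, truncMat_zero]
  rwa [block_hamiltonian, Finset.sum_congr rfl fun e _ => h0 e, Finset.sum_const_zero,
    add_zero] at h

theorem isSelfAdjoint_sum_potMat (U μ p : ℝ) (Y : Finset Λ) (ν : ℝ) (N : ℕ) (Z : Finset Λ) :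
    IsSelfAdjoint (∑ e ∈ edges Z, potMat U μ p Y ν N e) := by
  have h := isSelfAdjoint_block ((IsSectorHermitian.hamiltonian Λ 0 U μ p Z).barFormal Y ν) N
  have h0 : ∀ e : Λ × Λ, hopMat 0 Y ν N e = 0 := by
    intro e
    have : hop 0 e.1 e.2 = (0 : FormalOp Λ) := by simp [hop]
    rw [hopMat, this, truncMat_zero]
  rwa [block_hamiltonian, Finset.sum_congr rfl fun e _ => h0 e, Finset.sum_const_zero,
    zero_add] at h

theorem potMat_eq_diagonal (U μ p : ℝ) (Y : Finset Λ) (ν : ℝ) (N : ℕ) (e : Λ × Λ) :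
    potMat U μ p Y ν N e = Matrix.diagonal fun m => potMat U μ p Y ν N e m m := by
  ext m n
  by_cases h : m = n
  · rw [h, Matrix.diagonal_apply_eq]
  · rw [Matrix.diagonal_apply_ne _ h]
    have h' : m.1 ≠ n.1 := fun h' => h (Subtype.ext h')
    simp [potMat, truncMat, pot_eq_diag, elt_diag, h']

theorem commute_potMat_potMat (U μ p : ℝ) (Y : Finset Λ) (ν : ℝ) (N : ℕ) (e f : Λ × Λ) :
    Commute (potMat U μ p Y ν N e) (potMat U μ p Y ν N f) := by
  rw [potMat_eq_diagonal, potMat_eq_diagonal U μ p Y ν N f]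
  exact Matrix.commute_diagonal _ _

variable {J U μ p ν R : ℝ} {X Y : Finset Λ} {N : ℕ} {e f : Λ × Λ}

theorem commute_hopMat_hopMat (he : e.1 ≠ e.2) (hf : f.1 ≠ f.2) (h : Disjoint (ends e) (ends f)) :
    Commute (hopMat J Y ν N e) (hopMat J Y ν N f) :=
  commute_truncMat h (isLocalKernel_hop J he) (isLocalKernel_hop J hf) Y ν N

theorem commute_hopMat_potMat (he : e.1 ≠ e.2) (h : Disjoint (ends e) (ends f)) :
    Commute (hopMat J Y ν N e) (potMat U μ p Y ν N f) :=
  commute_truncMat h (isLocalKernel_hop J he) (isLocalKernel_pot U μ p f.1 f.2) Y ν N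

theorem commute_hopMat_truncMat {a : (Λ → ℕ) → (Λ → ℕ) → ℂ} (ha : IsLocalKernel X a)
    (he : e.1 ≠ e.2) (h : Disjoint (ends e) X) :
    Commute (hopMat J Y ν N e) (truncMat Y ν N a) :=
  commute_truncMat h (isLocalKernel_hop J he) ha Y ν N

theorem commute_potMat_truncMat {a : (Λ → ℕ) → (Λ → ℕ) → ℂ} (ha : IsLocalKernel X a)
    (h : Disjoint (ends e) X) : Commute (potMat U μ p Y ν N e) (truncMat Y ν N a) :=
  commute_truncMat h (isLocalKernel_pot U μ p e.1 e.2) ha Y ν N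

/-- A hopping term evolved with the interaction only involves the neighbouring sites. -/
theorem commute_conjDyn_hopMat {Z : Finset Λ} (he : e.1 ≠ e.2)
    {b : Matrix (sector Λ N) (sector Λ N) ℂ} (hb : Commute b (hopMat J Y ν N e))
    (hbv : ∀ g ∈ edges Z, ¬Disjoint (ends e) (ends g) → Commute b (potMat U μ p Y ν N g)) (r : ℝ) :
    Commute b (conjDyn (∑ g ∈ edges Z, potMat U μ p Y ν N g) r (hopMat J Y ν N e)) := by
  classical
  -- Interaction terms disjoint from `e` commute with the hopping term and with the other
  -- interaction terms, so they cancel from the conjugation.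
  rw [← Finset.sum_filter_not_add_sum_filter (edges Z) fun g => Disjoint (ends e) (ends g),
    conjDyn_add_of_commute]
  · refine commute_conjDyn (Commute.sum_right _ _ _ fun g hg => ?_) hb r
    obtain ⟨h1, h2⟩ := Finset.mem_filter.1 hg
    exact hbv g h1 h2
  · exact Commute.sum_left _ _ _ fun g _ => Commute.sum_right _ _ _ fun g' _ =>
      commute_potMat_potMat U μ p Y ν N g g'
  · exact Commute.sum_right _ _ _ fun g hg =>
      commute_hopMat_potMat he (Finset.mem_filter.1 hg).2

/-- Pairs of neighbouring sites near `e`. -/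
def nearEdges (e : Λ × Λ) : Finset (Λ × Λ) :=
  open scoped Classical in
  (edges (Finset.univ : Finset Λ)).filter fun f => latticeDist e.1.1 f.1.1 ≤ 3

theorem card_nearEdges_le (e : Λ × Λ) : ((nearEdges e).card : ℝ) ≤ 21 ^ d := by
  classical
  have h1 := card_edges_le (Finset.univ.filter fun y : Λ => latticeDist e.1.1 y.1 ≤ 3)
    (nearEdges e) (Finset.filter_subset _ _) fun f hf => by
      simpa using (Finset.mem_filter.1 hf).2
  have h2 := card_ball_le e.1 (by norm_num : (0 : ℝ) ≤ 3)
  calc _ ≤ _ := h1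
    _ ≤ (2 * 3 + 1) ^ d * 3 ^ d := by
      refine mul_le_mul_of_nonneg_right ?_ (by positivity)
      convert h2
    _ = _ := by rw [← mul_pow]; norm_num

/-- The radius three in `nearEdges` comes from a chain of three touching pairs `e`, `g`, `f`: each
contributes at most one to the distance between the first sites of `e` and `f`. -/
theorem disjoint_ends_of_not_mem_nearEdges (he : e ∈ edges (Finset.univ : Finset Λ))
    (hf : f ∈ edges (Finset.univ : Finset Λ)) (hfe : f ∉ nearEdges e) :
    Disjoint (ends f) (ends e) ∧ ∀ g ∈ edges (Finset.univ : Finset Λ),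
      ¬Disjoint (ends e) (ends g) → Disjoint (ends f) (ends g) := by
  have h3 : ¬latticeDist e.1.1 f.1.1 ≤ 3 := fun h => hfe (by
    classical
    exact Finset.mem_filter.2 ⟨hf, h⟩)
  refine ⟨?_, fun g hg hge => ?_⟩
  · refine Finset.disjoint_left.2 fun a haf hae => h3 ?_
    have h1 := latticeDist_ends_le he (fst_mem_ends e) hae
    have h2 := latticeDist_ends_le hf haf (fst_mem_ends f)
    have := latticeDist_triangle e.1.1 a.1 f.1.1
    linarith
  · obtain ⟨a, hae, hag⟩ := Finset.not_disjoint_iff.1 hge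
    refine Finset.disjoint_left.2 fun b hbf hbg => h3 ?_
    have h1 := latticeDist_ends_le he (fst_mem_ends e) hae
    have h2 := latticeDist_ends_le hg hag hbg
    have h4 := latticeDist_ends_le hf hbf (fst_mem_ends f)
    have h5 := latticeDist_triangle e.1.1 a.1 b.1
    have h6 := latticeDist_triangle e.1.1 b.1 f.1.1
    linarith

/-- The truncated Hamiltonian with hopping in `X[R - 1]` and interaction in `X[R]`, as a local
dynamics for an observable on `X`. -/
theorem localDynamics_hopMat {a : (Λ → ℕ) → (Λ → ℕ) → ℂ} (ha : IsLocalKernel X a) (hν : 0 ≤ ν)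
    (J U μ p R : ℝ) (N : ℕ) :
    LocalDynamics
      (∑ e ∈ edges (enlarge X (R - 1)), hopMat J (enlarge X (R + 2)) ν N e +
        ∑ e ∈ edges (enlarge X R), potMat U μ p (enlarge X (R + 2)) ν N e)
      (∑ e ∈ edges (enlarge X R), potMat U μ p (enlarge X (R + 2)) ν N e)
      (truncMat (enlarge X (R + 2)) ν N a)
      (hopMat J (enlarge X (R + 2)) ν N)
      (edges (enlarge X (R - 1)))
      (edges (enlarge X (R + 2)))
      -- The `2` is the reach of an evolved hopping term from `e.1`: across `e`, then across an
      -- adjacent interaction pair. The ratio `e^3` reflects the radius of `nearEdges`.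
      nearEdges (fun e => Real.exp (2 - distTo X e.1)) (|J| * ν) (Real.exp 3) (21 ^ d) where
  selfAdjoint := (isSelfAdjoint_sum_hopMat _ _ _ _ _).add (isSelfAdjoint_sum_potMat _ _ _ _ _ _ _)
  selfAdjoint_free := isSelfAdjoint_sum_potMat _ _ _ _ _ _ _
  sub_eq := add_sub_cancel_right _ _
  subset := fun f hf => edges_mono (enlarge_mono X (by linarith)) hf
  norm_le e he := norm_truncMat_hop_le J (ne_of_mem_edges he) (mem_of_mem_edges he (fst_mem_ends e))
    (mem_of_mem_edges he (snd_mem_ends e)) hν N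
  weight_pos e := Real.exp_pos _
  card_le e _ := card_nearEdges_le e
  weight_le e _ f hf := by
    classical
    rw [← Real.exp_add]
    refine Real.exp_le_exp.2 ?_
    have h1 := (Finset.mem_filter.1 hf).2
    have h2 := distTo_le_add X e.1 f.1
    linarith
  commute e he f hf hfe r := by
    have he' := mem_edges_univ he
    have hf' := mem_edges_univ hf
    obtain ⟨h1, h2⟩ := disjoint_ends_of_not_mem_nearEdges he' hf' hfe
    exact commute_conjDyn_hopMat (ne_of_mem_edges he)
      (commute_hopMat_hopMat (ne_of_mem_edges hf) (ne_of_mem_edges he) h1)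
      (fun g hg hge => commute_hopMat_potMat (ne_of_mem_edges hf)
        (h2 g (mem_edges_univ hg) hge)) r
  commute_observable e he hw r := by
    have he' := mem_edges_univ he
    rw [Real.exp_lt_one_iff] at hw
    refine (commute_conjDyn_hopMat (ne_of_mem_edges he)
      (commute_hopMat_truncMat ha (ne_of_mem_edges he) ?_).symm
      (fun g hg hge => (commute_potMat_truncMat ha ?_).symm) r).symm
    · refine Finset.disjoint_left.2 fun b hbe hbX => ?_
      have h1 := distTo_le e.1 hbX
      have h2 := latticeDist_ends_le he' (fst_mem_ends e) hbe
      linarith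
    · obtain ⟨c, hce, hcg⟩ := Finset.not_disjoint_iff.1 hge
      refine Finset.disjoint_left.2 fun b hbg hbX => ?_
      have h1 := distTo_le e.1 hbX
      have h2 := latticeDist_ends_le he' (fst_mem_ends e) hce
      have h3 := latticeDist_ends_le (mem_edges_univ hg) hcg hbg
      have h4 := latticeDist_triangle e.1.1 c.1 b.1
      linarith

/-- In each sector the dynamics generated by the truncation of `H_Z`, `Z ⊇ X[R]`, is close to the
one with hopping in `X[R - 1]` and interaction in `X[R]`. -/
theorem norm_conjDyn_block_sub_le {a : (Λ → ℕ) → (Λ → ℕ) → ℂ} (ha : IsLocalKernel X a)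
    (hν : 0 ≤ ν) (hR : 2 < R) (J U μ p : ℝ) (N : ℕ) {Z : Finset Λ} (hZ : enlarge X R ⊆ Z) (t : ℝ) :
    ‖conjDyn (block (barFormal (enlarge X (R + 2)) ν (hamiltonian Λ J U μ p Z)) N) t
          (truncMat (enlarge X (R + 2)) ν N a) -
        conjDyn (∑ e ∈ edges (enlarge X (R - 1)), hopMat J (enlarge X (R + 2)) ν N e +
          ∑ e ∈ edges (enlarge X R), potMat U μ p (enlarge X (R + 2)) ν N e) t
          (truncMat (enlarge X (R + 2)) ν N a)‖ ≤
      15 ^ d * X.card * R ^ d * ‖truncMat (enlarge X (R + 2)) ν N a‖ * Real.exp (4 - R) *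
        (Real.exp (|J| * ν * (4 * 21 ^ d * (1 + Real.exp 3)) * |t|) - 1) := by
  classical
  have L := localDynamics_hopMat ha hν J U μ p R N
  set Y := enlarge X (R + 2) with hY
  have hZ1 : enlarge X (R - 1) ⊆ enlarge X R := enlarge_mono X (by linarith)
  have hsub : edges (enlarge X (R - 1)) ⊆ edges Z := edges_mono (hZ1.trans hZ)
  have hXZ1 : X ⊆ enlarge X (R - 1) := subset_enlarge X (by linarith)
  -- `P`, `Q`, `W` split what the intermediate generator lacks. Pairs in `P` touch `X[R]`, hence lie
  -- in `X[R+1]`, where the cutoff acts. Pairs in `Q` are disjoint from `X[R]`, which carries the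
  -- whole intermediate generator. The interaction in `W` avoids `X[R-1]`, which carries its
  -- hopping.
  set P := (edges Z \ edges (enlarge X (R - 1))).filter
    fun e => ¬Disjoint (ends e) (enlarge X R) with hP
  set Q := (edges Z \ edges (enlarge X (R - 1))).filter
    fun e => Disjoint (ends e) (enlarge X R) with hQ
  set W := ∑ e ∈ edges Z \ edges (enlarge X R), potMat U μ p Y ν N e with hW
  have hPmem : ∀ e ∈ P, e ∈ edges (Finset.univ : Finset Λ) ∧ ∃ b ∈ ends e, b ∈ enlarge X R := by
    intro e he
    obtain ⟨h1, h2⟩ := Finset.mem_filter.1 he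
    exact ⟨mem_edges_univ (Finset.mem_sdiff.1 h1).1, Finset.not_disjoint_iff.1 h2⟩
  have hPY : ∀ e ∈ P, ∀ b ∈ ends e, b ∈ enlarge X (R + 1) := by
    intro e he b hb
    obtain ⟨h1, c, hc, hcR⟩ := hPmem e he
    exact mem_enlarge_of_dist_le hcR (latticeDist_ends_le h1 hc hb) le_rfl
  have hWdisj : ∀ g ∈ edges Z \ edges (enlarge X R),
      Disjoint (ends g) (enlarge X (R - 1)) := by
    intro g hg
    obtain ⟨h1, h2⟩ := Finset.mem_sdiff.1 hg
    refine Finset.disjoint_left.2 fun b hb hbR => h2 ?_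
    have h3 : ∀ c ∈ ends g, c ∈ enlarge X R := fun c hc =>
      mem_enlarge_of_dist_le hbR (latticeDist_ends_le (mem_edges_univ h1) hb hc) (by linarith)
    exact mem_edges.2 ⟨⟨h3 _ (fst_mem_ends g), h3 _ (snd_mem_ends g)⟩, (mem_edges.1 h1).2⟩
  have hends : ∀ {V : Finset Λ}, ∀ f ∈ edges V, ends f ⊆ V := fun f hf b hb =>
    mem_of_mem_edges hf hb
  have main := L.norm_conjDyn_sub_le (by positivity) (Real.exp_pos 3).le
    (one_le_pow₀ (by norm_num))
    (isSelfAdjoint_block ((IsSectorHermitian.hamiltonian Λ J U μ p Z).barFormal Y ν) N) P Q (W := W)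
    (ε := Real.exp (4 - R)) ?_ ?_ ?_ ?_ ?_ t
  · have hcard : (P.card : ℝ) ≤ 15 ^ d * X.card * R ^ d := by
      have h1 := card_edges_le (enlarge X (R + 1)) P (fun e he => (hPmem e he).1)
        fun e he => hPY e he _ (fst_mem_ends e)
      have h2 := card_enlarge_le X (by linarith : 0 ≤ R + 1)
      calc (P.card : ℝ) ≤ (enlarge X (R + 1)).card * 3 ^ d := h1
        _ ≤ X.card * (2 * (R + 1) + 1) ^ d * 3 ^ d := by gcongr
        -- Here `R > 2` absorbs the additive constant of `2 R + 3` into `5 R`.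
        _ ≤ X.card * (5 * R) ^ d * 3 ^ d := by
          have : 2 * (R + 1) + 1 ≤ 5 * R := by linarith
          have h0 : 0 ≤ 2 * (R + 1) + 1 := by linarith
          gcongr
        _ = _ := by
          have : (15 : ℝ) ^ d = 5 ^ d * 3 ^ d := by rw [← mul_pow]; norm_num
          rw [this, mul_pow]
          ring
    have hexp : 4 * (|J| * ν) * 21 ^ d * (1 + Real.exp 3) * |t| =
        |J| * ν * (4 * 21 ^ d * (1 + Real.exp 3)) * |t| := by ring
    rw [hexp] at main
    refine main.trans ?_
    have h0 : 0 ≤ Real.exp (|J| * ν * (4 * 21 ^ d * (1 + Real.exp 3)) * |t|) - 1 :=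
      sub_nonneg.2 (Real.one_le_exp (by positivity))
    gcongr
  · have h1 := Finset.sum_sdiff (f := hopMat J Y ν N) hsub
    have h2 := Finset.sum_sdiff (f := potMat U μ p Y ν N) (edges_mono hZ)
    have h3 := Finset.sum_filter_not_add_sum_filter (edges Z \ edges (enlarge X (R - 1)))
      (fun e => Disjoint (ends e) (enlarge X R)) (hopMat J Y ν N)
    rw [block_hamiltonian, h3, hW, ← h1, ← h2]
    abel
  · intro e he
    have h1 : ∀ b ∈ ends e, b ∈ Y := fun b hb =>
      enlarge_mono X (by linarith) (hPY e he b hb)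
    exact mem_edges.2 ⟨⟨h1 _ (fst_mem_ends e), h1 _ (snd_mem_ends e)⟩,
      (mem_edges.1 (hPmem e he).1).2⟩
  · intro e he r
    obtain ⟨h1, h2⟩ := Finset.mem_filter.1 he
    have hne := ne_of_mem_edges (Finset.mem_sdiff.1 h1).1
    refine commute_conjDyn (Commute.add_right ?_ ?_) ?_ r
    · exact Commute.sum_right _ _ _ fun f hf => commute_hopMat_hopMat hne (ne_of_mem_edges hf)
        (h2.mono_right ((hends f hf).trans hZ1))
    · exact Commute.sum_right _ _ _ fun f hf => commute_hopMat_potMat hne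
        (h2.mono_right (hends f hf))
    · exact commute_hopMat_truncMat ha hne (h2.mono_right (hXZ1.trans hZ1))
  · intro r
    refine commute_conjDyn (Commute.add_right ?_ ?_) ?_ r
    · exact Commute.sum_left _ _ _ fun g hg => Commute.sum_right _ _ _ fun f hf =>
        (commute_hopMat_potMat (ne_of_mem_edges hf)
          ((hWdisj g hg).mono_right (hends f hf)).symm).symm
    · exact Commute.sum_left _ _ _ fun g _ => Commute.sum_right _ _ _ fun f _ =>
        commute_potMat_potMat U μ p Y ν N g f
    · exact Commute.sum_left _ _ _ fun g hg =>
        commute_potMat_truncMat ha ((hWdisj g hg).mono_right hXZ1)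
  · intro e he
    obtain ⟨h1, b, hb, hbR⟩ := hPmem e he
    obtain ⟨x, hx, -⟩ := mem_enlarge.1 hbR
    refine Real.exp_le_exp.2 ?_
    -- Some end of `e` is at distance at least `R - 1` from `X`, so `e.1` is at distance at least `R
    -- - 2`, and the weight is at most `e^{2-(R-2)}`.
    obtain ⟨c, hc, hcR⟩ : ∃ c ∈ ends e, c ∉ enlarge X (R - 1) := by
      by_contra! h
      refine (Finset.mem_sdiff.1 (Finset.mem_filter.1 he).1).2 ?_
      exact mem_edges.2 ⟨⟨h _ (fst_mem_ends e), h _ (snd_mem_ends e)⟩, (mem_edges.1 h1).2⟩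
    have h2 := le_distTo ⟨x, hx⟩ hcR
    have h3 := distTo_le_add X c e.1
    have h4 := latticeDist_ends_le h1 hc (fst_mem_ends e)
    linarith

/-- The comparison of the truncated dynamics of `H` and `H_{X[R]}` in a sector. -/
theorem norm_conjDyn_block_sub_block_le {a : (Λ → ℕ) → (Λ → ℕ) → ℂ} (ha : IsLocalKernel X a)
    (hν : 0 ≤ ν) (hR : 2 < R) (J U μ p : ℝ) (N : ℕ) (t : ℝ) {c : ℝ}
    (hc : ‖truncMat (enlarge X (R + 2)) ν N a‖ ≤ c) :
    ‖conjDyn (block (barFormal (enlarge X (R + 2)) ν (hamiltonian Λ J U μ p Finset.univ)) N) t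
          (truncMat (enlarge X (R + 2)) ν N a) -
        conjDyn (block (barFormal (enlarge X (R + 2)) ν
          (hamiltonian Λ J U μ p (enlarge X R))) N) t (truncMat (enlarge X (R + 2)) ν N a)‖ ≤
      2 * 15 ^ d * Real.exp 4 * X.card * c * R ^ d * Real.exp (-R) *
        (Real.exp (|J| * ν * (4 * 21 ^ d * (1 + Real.exp 3)) * |t|) - 1) := by
  have h0 : 0 ≤ Real.exp (|J| * ν * (4 * 21 ^ d * (1 + Real.exp 3)) * |t|) - 1 :=
    sub_nonneg.2 (Real.one_le_exp (by positivity))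
  have hR0 : 0 < R := by linarith
  -- The triangle inequality through the intermediate dynamics, which is the same for `Z = Λ` and `Z
  -- = X[R]`; this costs the factor two.
  have h1 := norm_conjDyn_block_sub_le ha hν hR J U μ p N (Finset.subset_univ (enlarge X R)) t
  have h2 := norm_conjDyn_block_sub_le ha hν hR J U μ p N (Finset.Subset.refl (enlarge X R)) t
  rw [norm_sub_rev] at h2
  refine (norm_sub_le_norm_sub_add_norm_sub _ _ _).trans ((add_le_add h1 h2).trans ?_)
  rw [sub_eq_add_neg 4 R, Real.exp_add]
  set q := Real.exp (|J| * ν * (4 * 21 ^ d * (1 + Real.exp 3)) * |t|) - 1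
  calc _ = 2 * 15 ^ d * Real.exp 4 * X.card * ‖truncMat (enlarge X (R + 2)) ν N a‖ * R ^ d *
        Real.exp (-R) * q := by ring
    _ ≤ _ := by gcongr

end Sector

end BoseHubbard

end

/-! ### Assembly of the sectors. -/

open BoseHubbard
theorem proposition4p3 (d : ℕ) :
    ∃ C v : ℝ, 0 < C ∧ 0 < v ∧
      ∀ (Λ : Finset (Fin d → ℤ)) (J U μ p : ℝ), 1 ≤ p →
      ∀ (X : Finset Λ) (ν R : ℝ), 0 < ν → 2 < R →
      ∀ A : Fock Λ →L[ℂ] Fock Λ, IsInvariantLocal X A →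
      ∀ t : ℝ, |J| * ν * v * |t| ≤ R - 2 →
        ‖truncDynamics Λ J U μ p (enlarge X (R + 2)) ν Finset.univ t
              (barOp (enlarge X (R + 2)) ν A)
            - truncDynamics Λ J U μ p (enlarge X (R + 2)) ν (enlarge X R) t
              (barOp (enlarge X (R + 2)) ν A)‖
          ≤ C * X.card * ‖A‖ * R ^ d * Real.exp (-R) * (Real.exp (|J| * ν * v * |t|) - 1) := by
  -- In `C`, the factors are the two comparisons, the number of boundary pairs and the weight
  -- offset. `v` is the Lieb–Robinson rate `4 g D (1 + κ)` divided by `g = |J| ν`, with `D = 21 ^ d`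
  -- and `κ = e^3`.
  refine ⟨2 * 15 ^ d * Real.exp 4, 4 * 21 ^ d * (1 + Real.exp 3), by positivity, by positivity, ?_⟩
  intro Λ J U μ p _ X ν R hν hR A hA t _
  have hR0 : 0 < R := by linarith
  have h0 : 0 ≤ Real.exp (|J| * ν * (4 * 21 ^ d * (1 + Real.exp 3)) * |t|) - 1 :=
    sub_nonneg.2 (Real.one_le_exp (by positivity))
  have hb := hasBlocks_barOp hA.2 (enlarge X (R + 2)) ν
  exact ((hb.heisenberg _ _ t).sub (hb.heisenberg _ _ t)).norm_le (by positivity) fun N =>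
    norm_conjDyn_block_sub_block_le hA.isLocalKernel hν.le hR J U μ p N t
      ((hb.norm_block_le N).trans (norm_barOp_le _ _ _))
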